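/- Let $\mathcal P$ be the set of measurable $\rho:\mathbb R^d\to[0,\infty)$ with $\int\rho\,dx=1$ and $\int|x|^2\rho\,dx<\infty$. Assume (A1): $p_0^*\in\mathcal P$ has the form $p_0^*=e^{-G_0}$ with $G_0\in C^2$, $D^2G_0\in L^\infty$ and $|\nabla G_0|(x)\to\infty$ as $|x|\to\infty$; and (A2): $h:\mathbb R^d\to\mathbb R$ is $C^2$ with $h,\nabla h,D^2h\in L^\infty$. Fix $T>0$. For a continuous observation path $Z:[0,T]\to\mathbb R$ and sampling instants $0=t_0<t_1<\dots<t_N=T$ put $\Delta t_n=t_n-t_{n-1}$, $\Delta Z_n=Z_{t_n}-Z_{t_{n-1}}$, $Y_n=\Delta Z_n/\Delta t_n$. Let $\rho_0=p_0^*$ and, for $n=1,\dots,N$, let $\rho_n\in\mathcal P$ be a minimizer over $\mathcal P$ of $$I_n(\rho)=D(\rho\mid\rho_{n-1})+\frac{\Delta t_n}{2}\int\rho(x)\,(Y_n-h(x))^2\,dx,\qquad D(\rho\mid\rho_{n-1})=\int\rho\ln\frac{\rho}{\rho_{n-1}}\,dx .$$ Write $H^1(\mathbb R^d;\rho)$ for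 the functions that lie, together with their weak gradient, in $L^2(\mathbb R^d;\rho)$, and say that $\rho$ satisfies $\mathrm{PI}(\lambda)$ if $\int|f|^2\rho\,dx\le\lambda^{-1}\int|\nabla f|^2\rho\,dx$ for all $f\in H^1(\mathbb R^d;\rho)$ with $\int f\rho\,dx=0$. Then the minimizers exist, are unique up to Lebesgue-null sets, and satisfy the following. (i) For $0\le n\le N$, $\rho_n=e^{-G_n}$ a.e. with $G_n\in C^2$, and, uniformly in $n$ and in the choice of $N$ and of the instants (for a fixed path $Z$): $|\nabla G_n(x)|\le K(1+|x|)$, $|\nabla G_n|(x)\to\infty$ as $|x|\to\infty$, and $|D^2G_n|\le K$. (ii) For $1\le n\le N$, if $f\in L^2(\mathbb R^d;\rho_{n-1})$ then $f\in L^2(\mathbb R^d;\rho_n)$ and $$\int\rho_n|f|^2\,dx\le C\,e^{\alpha|\Delta Z_n|}\int\rho_{n-1}|f|^2\,dx,$$ where the constants $C,\alpha$ depend neither on $f$, $n$, $N$ and the instants nor on the path $Z$. (iii) For $1\le n\le N$, $\rho_n/\rho_{n-1}\in H^1(\mathbb R^d;\rho_{n-1})$. (iv) For each fixed path $Z$ there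 is $\bar\lambda>0$, independent of $N$ and of the instants, such that every $\rho_n$, $0\le n\le N$, satisfies $\mathrm{PI}(\bar\lambda)$. -/

import Mathlib

open MeasureTheory Filter Set
open scoped ENNReal ContDiff

noncomputable section

/-- The state space `ℝ^d` with its Euclidean norm. -/
abbrev State (d : ℕ) : Type := EuclideanSpace ℝ (Fin d)

/-- Hessian of a scalar function, as the derivative of its gradient. -/
def hessian {d : ℕ} (G : State d → ℝ) (x : State d) : State d →L[ℝ] State d :=
  fderiv ℝ (gradient G) x

/-- The measure `ρ(x) dx`. -/
def densityMeasure {d : ℕ} (ρ : State d → ℝ) : Measure (State d) :=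
  volume.withDensity (fun x => ENNReal.ofReal (ρ x))

/-- The class `𝒫` of probability densities with finite second moment. -/
structure IsDensity {d : ℕ} (ρ : State d → ℝ) : Prop where
  measurable : Measurable ρ
  nonneg : ∀ x, 0 ≤ ρ x
  integrable : Integrable ρ
  integral_eq_one : ∫ x, ρ x = 1
  second_moment : Integrable (fun x => ‖x‖ ^ 2 * ρ x)

/-- `f ∈ L²(ℝ^d; ρ)`, for scalar functions and for vector fields. -/
def MemL2 {d : ℕ} {F : Type*} [NormedAddCommGroup F] (f : State d → F) (ρ : State d → ℝ) : Prop :=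
  MemLp f 2 (densityMeasure ρ)

/-- `g` is the gradient of `f` in the weak (distributional) sense. -/
structure HasWeakGradient {d : ℕ} (f : State d → ℝ) (g : State d → State d) : Prop where
  locallyIntegrable : LocallyIntegrable f
  locallyIntegrable_grad : LocallyIntegrable g
  integral_eq : ∀ φ : State d → ℝ, ContDiff ℝ ∞ φ → HasCompactSupport φ → ∀ v : State d,
    ∫ x, f x * fderiv ℝ φ x v = - ∫ x, inner ℝ (g x) v * φ x

/-- `f ∈ H¹(ℝ^d; ρ)`: both `f` and its weak gradient lie in `L²(ℝ^d; ρ)`. -/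
def MemH1 {d : ℕ} (f : State d → ℝ) (ρ : State d → ℝ) : Prop :=
  MemL2 f ρ ∧ ∃ g : State d → State d, HasWeakGradient f g ∧ MemL2 g ρ

/-- The Poincaré inequality `PI(lam)` for the density `ρ`: it is quantified over all `f ∈ H¹(ρ)`
(with weak gradient `g`) of mean zero. -/
def PoincareInequality {d : ℕ} (ρ : State d → ℝ) (lam : ℝ) : Prop :=
  ∀ (f : State d → ℝ) (g : State d → State d),
    MemL2 f ρ → HasWeakGradient f g → MemL2 g ρ → ∫ x, ρ x * f x = 0 →
      ∫ x, |f x| ^ 2 * ρ x ≤ 1 / lam * ∫ x, ‖g x‖ ^ 2 * ρ x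

/-- Assumption on the prior: `p₀ ∈ 𝒫`, `p₀ = exp(-G₀)` with `G₀ ∈ C²`, `D²G₀ ∈ L^∞` and
`|∇G₀|(x) → ∞` as `|x| → ∞`. -/
def AssumptionA1 {d : ℕ} (p₀ : State d → ℝ) : Prop :=
  IsDensity p₀ ∧ ∃ G₀ : State d → ℝ,
    (∀ x, p₀ x = Real.exp (-G₀ x)) ∧
    ContDiff ℝ 2 G₀ ∧
    MemLp (hessian G₀) ∞ ∧
    Tendsto (fun x => ‖gradient G₀ x‖) (cocompact (State d)) atTop

/-- Assumption on the observation function: `h ∈ C²` with `h, ∇h, D²h ∈ L^∞`. -/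
def AssumptionA2 {d : ℕ} (h : State d → ℝ) : Prop :=
  ContDiff ℝ 2 h ∧ MemLp h ∞ ∧ MemLp (gradient h) ∞ ∧ MemLp (hessian h) ∞

/-- Sampling instants `0 = t₀ < t₁ < ⋯ < t_N = T`. -/
structure IsPartition (T : ℝ) (N : ℕ) (t : ℕ → ℝ) : Prop where
  zero : t 0 = 0
  last : t N = T
  lt_succ : ∀ n < N, t n < t (n + 1)

/-- Increment `Δa_{n+1} = a_{n+1} - a_n` of a sequence. -/
def increment (a : ℕ → ℝ) (n : ℕ) : ℝ := a (n + 1) - a n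

/-- The functional `I(ρ) = D(ρ | ρprev) + (Δt / 2) ∫ ρ(x) (Y - h(x))² dx` with `Y = ΔZ / Δt`,
valued in `[0, ∞]`; `D` is the relative entropy. -/
def objective {d : ℕ} (h : State d → ℝ) (Δt ΔZ : ℝ) (ρprev ρ : State d → ℝ) : ℝ≥0∞ :=
  InformationTheory.klDiv (densityMeasure ρ) (densityMeasure ρprev)
    + ENNReal.ofReal (Δt / 2) * ∫⁻ x, ENNReal.ofReal (ρ x * (ΔZ / Δt - h x) ^ 2)

/-- `ρ₀, …, ρ_N` is an output of the time-stepping procedure for the prior `p₀`, the observation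
function `h`, the sampling instants `t` and the observation path `Z`: `ρ₀ = p₀`, and each `ρ_{n+1}`
is a minimizer over `𝒫` of the functional built on `ρ_n`. -/
structure IsTimeStepping {d : ℕ} (p₀ h : State d → ℝ) (N : ℕ) (t : ℕ → ℝ) (Z : ℝ → ℝ)
    (ρ : ℕ → State d → ℝ) : Prop where
  initial : ρ 0 = p₀
  mem : ∀ n < N, IsDensity (ρ (n + 1))
  minimizes : ∀ n < N, ∀ σ : State d → ℝ, IsDensity σ →
    objective h (increment t n) (increment (Z ∘ t) n) (ρ n) (ρ (n + 1)) ≤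
      objective h (increment t n) (increment (Z ∘ t) n) (ρ n) σ

end

/-! ### Density measures and Gibbs densities -/

namespace DataAssimilation

open InformationTheory

variable {d : ℕ}

/-! Each step is solved explicitly. By the Gibbs variational principle the functional equals a
constant plus the relative entropy with respect to the density proportional to `ρ_{n-1}
exp(-(Δt/2)(Y - h)²)`, so that density is the only minimizer. Expanding the square and dropping what
does not depend on `x`, the exponent becomes `ΔZ h - (Δt/2) h²`. The increments telescope, so `ρ_n`
is proportional to `p₀ exp q` with `q = (Z_{t_n} - Z_0) h - (t_n/2) h²`
(`IsTimeStepping.ae_eq_posterior`).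

A path continuous on `[0, T]` is bounded there, so `q`, `∇q` and `D²q` are bounded uniformly in the
partition. This gives (i), since the potential of `ρ_n` is `G₀ - q` plus a constant. A one-step
exponent oscillates by at most `2H|ΔZ| + (T/2)H²`, where `H` bounds `|h|`, which gives (ii); the
ratio in (iii) is the exponential of this exponent divided by a constant.

For (iv), a Poincaré inequality for `p₀` is transferred by the Holley–Stroock argument: densities
with bounded ratios have comparable Poincaré constants. For `p₀` itself, integration by parts bounds
`∫|∇G|²ψ²ρ` by `4∫|∇ψ|²ρ + 2dK∫ψ²ρ` (`integral_sq_mul_inner_gradient_sq_le`, summed over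
coordinates). Where `|∇G|² ≥ 2dK + 1` the left side wins, so only the mass of `ψ²` on a ball
remains. There `ρ` is bounded above and below, and the Poincaré inequality on balls applies
(`exists_differenceEnergy_le_of_contDiff`). Cutoff and mollification extend the estimate from
compactly supported `C¹` functions to weakly differentiable ones.

The estimates are phrased through the double integral `∬|f(x) - f(y)|²` rather than the variance: it
involves no mean, is monotone in the measure and passes to a.e. limits by Fatou. -/

lemma integral_densityMeasure {F : Type*} [NormedAddCommGroup F] [NormedSpace ℝ F]
    {ρ : State d → ℝ} (hm : Measurable ρ) (h0 : ∀ x, 0 ≤ ρ x) (f : State d → F) :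
    ∫ x, f x ∂densityMeasure ρ = ∫ x, ρ x • f x := by
  rw [densityMeasure, integral_withDensity_eq_integral_toReal_smul (by fun_prop) (by simp)]
  simp [h0]

lemma lintegral_densityMeasure {ρ : State d → ℝ} (hm : Measurable ρ) (f : State d → ℝ≥0∞) :
    ∫⁻ x, f x ∂densityMeasure ρ = ∫⁻ x, ENNReal.ofReal (ρ x) * f x := by
  rw [densityMeasure, lintegral_withDensity_eq_lintegral_mul_non_measurable _ (by fun_prop)
    (by simp)]
  simp

lemma integrable_densityMeasure_iff {F : Type*} [NormedAddCommGroup F] [NormedSpace ℝ F]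
    {ρ : State d → ℝ} (hm : Measurable ρ) (h0 : ∀ x, 0 ≤ ρ x) (f : State d → F) :
    Integrable f (densityMeasure ρ) ↔ Integrable (fun x => ρ x • f x) := by
  rw [densityMeasure, integrable_withDensity_iff_integrable_smul' (by fun_prop) (by simp)]
  simp [h0]

lemma densityMeasure_congr {ρ σ : State d → ℝ} (h : ρ =ᵐ[volume] σ) :
    densityMeasure ρ = densityMeasure σ :=
  withDensity_congr_ae (by filter_upwards [h] with x hx; rw [hx])

lemma densityMeasure_mono {ρ σ : State d → ℝ} {c : ℝ} (hc : 0 ≤ c) (h : ∀ x, ρ x ≤ c * σ x) :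
    densityMeasure ρ ≤ ENNReal.ofReal c • densityMeasure σ := by
  rw [densityMeasure, densityMeasure, ← withDensity_smul' _ _ (by simp)]
  refine withDensity_mono (ae_of_all _ fun x => ?_)
  simpa [← ENNReal.ofReal_mul hc] using ENNReal.ofReal_le_ofReal (h x)

end DataAssimilation

namespace IsDensity

variable {d : ℕ} {p : State d → ℝ}

lemma isProbabilityMeasure (hp : IsDensity p) : IsProbabilityMeasure (densityMeasure p) := by
  constructor
  rw [densityMeasure, withDensity_apply _ MeasurableSet.univ, Measure.restrict_univ,
    ← ofReal_integral_eq_lintegral_ofReal hp.integrable (ae_of_all _ hp.nonneg),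
    hp.integral_eq_one, ENNReal.ofReal_one]

lemma ae_eq_of_densityMeasure_eq {q : State d → ℝ} (hp : IsDensity p) (hq : IsDensity q)
    (h : densityMeasure p = densityMeasure q) : p =ᵐ[volume] q := by
  have h' := (withDensity_eq_iff_of_sigmaFinite hp.measurable.ennreal_ofReal.aemeasurable
    hq.measurable.ennreal_ofReal.aemeasurable).1 h
  filter_upwards [h'] with x hx
  exact (ENNReal.ofReal_eq_ofReal_iff (hp.nonneg x) (hq.nonneg x)).1 hx

lemma integrable_mul_exp (hp : IsDensity p) {q : State d → ℝ} (hq : Measurable q) {b : ℝ}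
    (hb : ∀ x, q x ≤ b) : Integrable (fun x => p x * Real.exp (q x)) := by
  refine (hp.integrable.mul_const (Real.exp b)).mono'
    (hp.measurable.mul hq.exp).aestronglyMeasurable (ae_of_all _ fun x => ?_)
  rw [Real.norm_of_nonneg (mul_nonneg (hp.nonneg x) (Real.exp_nonneg _))]
  exact mul_le_mul_of_nonneg_left (Real.exp_le_exp.2 (hb x)) (hp.nonneg x)

lemma exp_le_integral_mul_exp (hp : IsDensity p) {q : State d → ℝ} (hq : Measurable q) {a b : ℝ}
    (ha : ∀ x, a ≤ q x) (hb : ∀ x, q x ≤ b) :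
    Real.exp a ≤ ∫ x, p x * Real.exp (q x) := by
  calc Real.exp a = ∫ x, p x * Real.exp a := by
        rw [integral_mul_const, hp.integral_eq_one, one_mul]
    _ ≤ _ := integral_mono (hp.integrable.mul_const _) (hp.integrable_mul_exp hq hb) fun x =>
        mul_le_mul_of_nonneg_left (Real.exp_le_exp.2 (ha x)) (hp.nonneg x)

lemma integral_mul_exp_le_exp (hp : IsDensity p) {q : State d → ℝ} (hq : Measurable q) {b : ℝ}
    (hb : ∀ x, q x ≤ b) :
    ∫ x, p x * Real.exp (q x) ≤ Real.exp b := by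
  calc ∫ x, p x * Real.exp (q x) ≤ ∫ x, p x * Real.exp b :=
        integral_mono (hp.integrable_mul_exp hq hb) (hp.integrable.mul_const _) fun x =>
        mul_le_mul_of_nonneg_left (Real.exp_le_exp.2 (hb x)) (hp.nonneg x)
    _ = Real.exp b := by rw [integral_mul_const, hp.integral_eq_one, one_mul]

end IsDensity

namespace DataAssimilation

open InformationTheory

variable {d : ℕ}

/-- The normalized density proportional to `p * exp q`. -/
noncomputable def gibbsDensity (p q : State d → ℝ) : State d → ℝ :=
  fun x => p x * Real.exp (q x) / ∫ y, p y * Real.exp (q y)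

section Gibbs

variable {p q : State d → ℝ} {a b : ℝ}

lemma integral_mul_exp_pos (hp : IsDensity p) (hq : Measurable q)
    (ha : ∀ x, a ≤ q x) (hb : ∀ x, q x ≤ b) : 0 < ∫ x, p x * Real.exp (q x) :=
  (Real.exp_pos a).trans_le (hp.exp_le_integral_mul_exp hq ha hb)

/-- The normalizing integral is at least `exp a` while the weight is at most `exp b`. With the
reverse bound `le_gibbsDensity`, only the oscillation `b - a` enters, which gives the comparability
used in (ii) and (iv). -/
lemma gibbsDensity_le (hp : IsDensity p) (hq : Measurable q)
    (ha : ∀ x, a ≤ q x) (hb : ∀ x, q x ≤ b) (x : State d) :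
    gibbsDensity p q x ≤ Real.exp (b - a) * p x := by
  have h0 := integral_mul_exp_pos hp hq ha hb
  rw [gibbsDensity, div_le_iff₀ h0]
  have h1 := hp.exp_le_integral_mul_exp hq ha hb
  calc p x * Real.exp (q x) ≤ p x * Real.exp b :=
        mul_le_mul_of_nonneg_left (Real.exp_le_exp.2 (hb x)) (hp.nonneg x)
    _ = Real.exp (b - a) * p x * Real.exp a := by
        rw [show b = (b - a) + a by ring, Real.exp_add]; ring_nf
    _ ≤ _ := mul_le_mul_of_nonneg_left h1 (mul_nonneg (Real.exp_nonneg _) (hp.nonneg x))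

lemma le_gibbsDensity (hp : IsDensity p) (hq : Measurable q)
    (ha : ∀ x, a ≤ q x) (hb : ∀ x, q x ≤ b) (x : State d) :
    p x ≤ Real.exp (b - a) * gibbsDensity p q x := by
  have h0 := integral_mul_exp_pos hp hq ha hb
  rw [gibbsDensity, ← mul_div_assoc, le_div_iff₀ h0]
  have h1 := hp.integral_mul_exp_le_exp hq hb
  calc p x * ∫ x, p x * Real.exp (q x) ≤ p x * Real.exp b :=
        mul_le_mul_of_nonneg_left h1 (hp.nonneg x)
    _ = Real.exp (b - a) * (p x * Real.exp a) := by
        rw [show b = (b - a) + a by ring, Real.exp_add]; ring_nf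
    _ ≤ _ := mul_le_mul_of_nonneg_left (mul_le_mul_of_nonneg_left
        (Real.exp_le_exp.2 (ha x)) (hp.nonneg x)) (Real.exp_nonneg _)

lemma isDensity_gibbsDensity (hp : IsDensity p) (hq : Measurable q)
    (ha : ∀ x, a ≤ q x) (hb : ∀ x, q x ≤ b) : IsDensity (gibbsDensity p q) := by
  have h0 := integral_mul_exp_pos hp hq ha hb
  have hm : Measurable (gibbsDensity p q) := (hp.measurable.mul hq.exp).div_const _
  have hn : ∀ x, 0 ≤ gibbsDensity p q x := fun x =>
    div_nonneg (mul_nonneg (hp.nonneg x) (Real.exp_nonneg _)) h0.le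
  refine ⟨hm, hn, (hp.integrable_mul_exp hq hb).div_const _, ?_, ?_⟩
  · simp only [gibbsDensity]
    rw [integral_div, div_self h0.ne']
  · refine (hp.second_moment.const_mul (Real.exp (b - a))).mono' (by fun_prop)
      (ae_of_all _ fun x => ?_)
    rw [Real.norm_of_nonneg (mul_nonneg (by positivity) (hn x))]
    calc ‖x‖ ^ 2 * gibbsDensity p q x ≤ ‖x‖ ^ 2 * (Real.exp (b - a) * p x) :=
          mul_le_mul_of_nonneg_left (gibbsDensity_le hp hq ha hb x) (by positivity)
      _ = _ := by ring

lemma densityMeasure_gibbsDensity (hp : IsDensity p) (hq : Measurable q) :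
    densityMeasure (gibbsDensity p q) = (densityMeasure p).tilted q := by
  rw [Measure.tilted, integral_densityMeasure hp.measurable hp.nonneg]
  have hpm := hp.measurable
  simp only [densityMeasure, smul_eq_mul]
  rw [← withDensity_mul _ (by fun_prop) (by fun_prop)]
  congr 1
  ext x
  simp only [gibbsDensity, Pi.mul_apply]
  rw [← ENNReal.ofReal_mul (hp.nonneg x), mul_div_assoc]

lemma gibbsDensity_zero (hp : IsDensity p) : gibbsDensity p (fun _ => 0) = p := by
  ext x; simp [gibbsDensity, hp.integral_eq_one]

lemma gibbsDensity_sub_const (p q : State d → ℝ) (c : ℝ) :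
    gibbsDensity p (fun x => q x - c) = gibbsDensity p q := by
  ext x
  simp only [gibbsDensity, Real.exp_sub, ← mul_div_assoc]
  rw [integral_div, div_div_div_cancel_right₀ (Real.exp_ne_zero _)]

/-- Exponents add and the intermediate normalization cancels; this is what makes the steps
telescope. -/
lemma gibbsDensity_gibbsDensity (hp : IsDensity p) (hq : Measurable q)
    (ha : ∀ x, a ≤ q x) (hb : ∀ x, q x ≤ b) (r : State d → ℝ) :
    gibbsDensity (gibbsDensity p q) r = gibbsDensity p (fun x => q x + r x) := by
  have h0 := integral_mul_exp_pos hp hq ha hb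
  ext x
  simp only [gibbsDensity, Real.exp_add, ← mul_assoc, div_mul_eq_mul_div]
  rw [integral_div, div_div_div_cancel_right₀ h0.ne']

lemma gibbsDensity_congr {p' : State d → ℝ} (h : p =ᵐ[volume] p') (q : State d → ℝ) :
    gibbsDensity p q =ᵐ[volume] gibbsDensity p' q := by
  have h1 : ∫ y, p y * Real.exp (q y) = ∫ y, p' y * Real.exp (q y) :=
    integral_congr_ae (by filter_upwards [h] with y hy; rw [hy])
  filter_upwards [h] with x hx
  simp only [gibbsDensity, h1, hx]

end Gibbs

/-! ### The Gibbs variational principle -/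

section Variational

variable {Ω : Type*} [MeasurableSpace Ω] {μ ν : Measure Ω} [IsProbabilityMeasure μ]
  [IsProbabilityMeasure ν]

/-- Gibbs variational principle for a bounded nonnegative energy. -/
lemma klDiv_add_lintegral_eq {V : Ω → ℝ} {B : ℝ} (hV : Measurable V) (h0 : ∀ x, 0 ≤ V x)
    (hB : ∀ x, V x ≤ B) :
    klDiv ν μ + ∫⁻ x, ENNReal.ofReal (V x) ∂ν =
      klDiv ν (μ.tilted fun x => -V x) +
        ENNReal.ofReal (-Real.log (∫ x, Real.exp (-V x) ∂μ)) := by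
  have hVint : ∀ (P : Measure Ω) [IsProbabilityMeasure P], Integrable V P := fun P _ =>
    Integrable.of_bound hV.aestronglyMeasurable B
      (ae_of_all _ fun x => by rw [Real.norm_of_nonneg (h0 x)]; exact hB x)
  have hexp : Integrable (fun x => Real.exp (-V x)) μ :=
    Integrable.of_bound hV.neg.exp.aestronglyMeasurable 1
      (ae_of_all _ fun x => by
        rw [Real.norm_of_nonneg (Real.exp_nonneg _)]
        exact Real.exp_le_one_iff.2 (by linarith [h0 x]))
  have hpγ : IsProbabilityMeasure (μ.tilted fun x => -V x) := isProbabilityMeasure_tilted hexp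
  have hle : ∫ x, Real.exp (-V x) ∂μ ≤ 1 := by
    calc ∫ x, Real.exp (-V x) ∂μ ≤ ∫ _, (1 : ℝ) ∂μ :=
          integral_mono hexp (integrable_const _) fun x =>
            Real.exp_le_one_iff.2 (by linarith [h0 x])
      _ = 1 := by simp
  have hpos : 0 < ∫ x, Real.exp (-V x) ∂μ := integral_exp_pos hexp
  -- Nonnegativity ensures that `ENNReal.ofReal` does not truncate the constant.
  have hlog : 0 ≤ -Real.log (∫ x, Real.exp (-V x) ∂μ) := by
    linarith [Real.log_nonpos hpos.le hle]
  have hγμ : (μ.tilted fun x => -V x) ≪ μ := tilted_absolutelyContinuous _ _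
  have hμγ : μ ≪ μ.tilted fun x => -V x := absolutelyContinuous_tilted hexp
  by_cases hfin : ν ≪ μ ∧ Integrable (llr ν μ) ν
  · obtain ⟨hac, hint⟩ := hfin
    have hint' := integrable_llr_tilted_right hac (hVint ν).neg hint hexp
    have h1 : klDiv ν μ ≠ ⊤ := klDiv_ne_top hac hint
    have h2 : klDiv ν (μ.tilted fun x => -V x) ≠ ⊤ := klDiv_ne_top (hac.trans hμγ) hint'
    rw [← ofReal_integral_eq_lintegral_ofReal (hVint ν) (ae_of_all _ h0),
      ← ENNReal.ofReal_toReal h1, ← ENNReal.ofReal_toReal h2,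
      ← ENNReal.ofReal_add ENNReal.toReal_nonneg (integral_nonneg h0),
      ← ENNReal.ofReal_add ENNReal.toReal_nonneg hlog,
      toReal_klDiv_of_measure_eq hac (by simp),
      toReal_klDiv_of_measure_eq (hac.trans hμγ) (by simp)]
    have hllr := integral_llr_tilted_right hac (hVint ν).neg hexp hint
    simp only [Pi.neg_apply, integral_neg] at hllr
    replace hllr : ∫ a, llr ν (μ.tilted fun x => -V x) a ∂ν =
      ∫ x, llr ν μ x ∂ν - -∫ x, V x ∂ν + Real.log (∫ x, Real.exp (-V x) ∂μ) := hllr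
    rw [hllr]
    congr 1
    ring
  -- The two log-likelihood ratios differ by a bounded function, so the entropies are infinite
  -- together.
  · have h1 : klDiv ν μ = ⊤ := by
      by_contra h
      exact hfin (klDiv_ne_top_iff.1 h)
    have h2 : klDiv ν (μ.tilted fun x => -V x) = ⊤ := by
      by_contra h
      obtain ⟨hac, hint⟩ := klDiv_ne_top_iff.1 h
      refine hfin ⟨hac.trans hγμ, ?_⟩
      have hae := llr_tilted_right (hac.trans hγμ) hexp
      refine ((hint.sub (hVint ν)).sub
        (integrable_const (Real.log (∫ x, Real.exp (-V x) ∂μ)))).congr ?_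
      filter_upwards [hae] with x hx
      simp only [Pi.sub_apply]
      rw [hx]
      ring
    rw [h1, h2, top_add, top_add]

end Variational

/-! ### One step of the minimizing movement scheme -/

section Step

variable {h p p' : State d → ℝ} {H Δt ΔZ : ℝ}

/-- The log-likelihood increment `ΔZ h - (Δt / 2) h²`. -/
noncomputable def logLikelihood (h : State d → ℝ) (Δt ΔZ : ℝ) (x : State d) : ℝ :=
  ΔZ * h x - Δt / 2 * h x ^ 2

lemma logLikelihood_le (hH : ∀ x, |h x| ≤ H) (hΔt : 0 ≤ Δt) (x : State d) :
    logLikelihood h Δt ΔZ x ≤ |ΔZ| * H := by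
  have h1 : ΔZ * h x ≤ |ΔZ| * H := by
    calc ΔZ * h x ≤ |ΔZ| * |h x| := by rw [← abs_mul]; exact le_abs_self _
      _ ≤ _ := mul_le_mul_of_nonneg_left (hH x) (abs_nonneg _)
  have h2 : 0 ≤ Δt / 2 * h x ^ 2 := by positivity
  unfold logLikelihood
  linarith

lemma le_logLikelihood (hH : ∀ x, |h x| ≤ H) (hΔt : 0 ≤ Δt) (x : State d) :
    -(|ΔZ| * H + Δt / 2 * H ^ 2) ≤ logLikelihood h Δt ΔZ x := by
  have h1 : -(|ΔZ| * H) ≤ ΔZ * h x := by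
    have : |ΔZ * h x| ≤ |ΔZ| * H := by
      rw [abs_mul]; exact mul_le_mul_of_nonneg_left (hH x) (abs_nonneg _)
    linarith [neg_abs_le (ΔZ * h x)]
  have h2 : Δt / 2 * h x ^ 2 ≤ Δt / 2 * H ^ 2 :=
    mul_le_mul_of_nonneg_left (sq_le_sq' (by linarith [neg_abs_le (h x), hH x])
      ((le_abs_self _).trans (hH x))) (by positivity)
  unfold logLikelihood
  linarith

lemma measurable_logLikelihood (hh : Measurable h) : Measurable (logLikelihood h Δt ΔZ) := by
  unfold logLikelihood; fun_prop

lemma isDensity_gibbsDensity_logLikelihood (hp : IsDensity p) (hh : Measurable h)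
    (hH : ∀ x, |h x| ≤ H) (hΔt : 0 ≤ Δt) : IsDensity (gibbsDensity p (logLikelihood h Δt ΔZ)) :=
  isDensity_gibbsDensity hp (measurable_logLikelihood hh) (le_logLikelihood hH hΔt)
    (logLikelihood_le hH hΔt)

/-- Expanding the square, the two exponents differ by the constant `ΔZ² / (2Δt)`, which
normalization removes. The factor `1 / Δt`, unbounded under refinement, disappears with it. -/
lemma gibbsDensity_neg_misfit (p : State d → ℝ) (hΔt : 0 < Δt) :
    gibbsDensity p (fun x => -(Δt / 2 * (ΔZ / Δt - h x) ^ 2)) =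
      gibbsDensity p (logLikelihood h Δt ΔZ) := by
  rw [← gibbsDensity_sub_const p (logLikelihood h Δt ΔZ) (ΔZ ^ 2 / (2 * Δt))]
  congr 1
  ext x
  simp only [logLikelihood]
  field_simp
  ring

/-- The variational principle for the misfit energy: the second summand is finite and independent of
`ρ`. -/
lemma objective_eq {ρ : State d → ℝ} (hp : IsDensity p) (hρ : IsDensity ρ) (hh : Measurable h)
    (hH : ∀ x, |h x| ≤ H) (hΔt : 0 < Δt) :
    objective h Δt ΔZ p ρ =
      klDiv (densityMeasure ρ) (densityMeasure (gibbsDensity p (logLikelihood h Δt ΔZ))) +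
      ENNReal.ofReal (-Real.log (∫ x, Real.exp (-(Δt / 2 * (ΔZ / Δt - h x) ^ 2))
        ∂densityMeasure p)) := by
  have := hp.isProbabilityMeasure
  have := hρ.isProbabilityMeasure
  have hV : Measurable fun x => Δt / 2 * (ΔZ / Δt - h x) ^ 2 := by fun_prop
  have h0 : ∀ x, 0 ≤ Δt / 2 * (ΔZ / Δt - h x) ^ 2 := fun x => by positivity
  have hB : ∀ x, Δt / 2 * (ΔZ / Δt - h x) ^ 2 ≤ Δt / 2 * (|ΔZ / Δt| + H) ^ 2 := fun x => by
    refine mul_le_mul_of_nonneg_left ?_ (by positivity)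
    rw [← sq_abs (ΔZ / Δt - h x)]
    exact pow_le_pow_left₀ (abs_nonneg _) ((abs_sub _ _).trans (by linarith [hH x])) 2
  rw [← gibbsDensity_neg_misfit p hΔt, densityMeasure_gibbsDensity
    (q := fun x => -(Δt / 2 * (ΔZ / Δt - h x) ^ 2)) hp hV.neg,
    ← klDiv_add_lintegral_eq (ν := densityMeasure ρ) hV h0 hB, objective,
    lintegral_densityMeasure hρ.measurable, ← lintegral_const_mul' _ _ ENNReal.ofReal_ne_top]
  congr 2
  ext x
  rw [ENNReal.ofReal_mul (hρ.nonneg x), ENNReal.ofReal_mul (p := Δt / 2) (by positivity)]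
  ring

lemma objective_congr_prev {ρ : State d → ℝ} (hpp : p =ᵐ[volume] p') :
    objective h Δt ΔZ p ρ = objective h Δt ΔZ p' ρ := by
  rw [objective, objective, densityMeasure_congr hpp]

/-- Relative entropy vanishes exactly when the two measures agree. The previous density enters up to
null sets because minimizers are determined only that far. -/
lemma forall_objective_le_iff {ρ : State d → ℝ} (hp : IsDensity p) (hpp : p' =ᵐ[volume] p)
    (hρ : IsDensity ρ) (hh : Measurable h) (hH : ∀ x, |h x| ≤ H) (hΔt : 0 < Δt) :
    (∀ σ, IsDensity σ → objective h Δt ΔZ p' ρ ≤ objective h Δt ΔZ p' σ) ↔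
      ρ =ᵐ[volume] gibbsDensity p (logLikelihood h Δt ΔZ) := by
  have hγ : IsDensity (gibbsDensity p (logLikelihood h Δt ΔZ)) :=
    isDensity_gibbsDensity_logLikelihood hp hh hH hΔt.le
  have := hγ.isProbabilityMeasure
  have := hρ.isProbabilityMeasure
  simp only [objective_congr_prev hpp]
  constructor
  · intro hmin
    have h1 := hmin _ hγ
    rw [objective_eq hp hρ hh hH hΔt, objective_eq hp hγ hh hH hΔt, klDiv_self] at h1
    have h2 := ENNReal.le_of_add_le_add_right ENNReal.ofReal_ne_top h1
    exact hρ.ae_eq_of_densityMeasure_eq hγ (klDiv_eq_zero_iff.1 (le_antisymm h2 zero_le))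
  · intro hae σ hσ
    rw [objective_eq hp hρ hh hH hΔt, objective_eq hp hσ hh hH hΔt, densityMeasure_congr hae,
      klDiv_self]
    gcongr
    exact zero_le

end Step

/-! ### The time-stepping procedure -/

section TimeStepping

variable {h p₀ : State d → ℝ} {H T : ℝ} {N : ℕ} {t : ℕ → ℝ} {Z : ℝ → ℝ}

lemma _root_.IsPartition.monotoneOn (ht : IsPartition T N t) {m n : ℕ} (hmn : m ≤ n)
    (hn : n ≤ N) : t m ≤ t n := by
  induction n, hmn using Nat.le_induction with
  | base => exact le_rfl
  | succ k hk ih => exact (ih (by omega)).trans (ht.lt_succ k (by omega)).le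

lemma _root_.IsPartition.mem_Icc (ht : IsPartition T N t) {n : ℕ} (hn : n ≤ N) :
    t n ∈ Icc 0 T :=
  ⟨ht.zero ▸ ht.monotoneOn (Nat.zero_le n) hn, ht.last ▸ ht.monotoneOn hn le_rfl⟩

lemma _root_.IsPartition.increment_pos (ht : IsPartition T N t) {n : ℕ} (hn : n < N) :
    0 < increment t n := sub_pos.2 (ht.lt_succ n hn)

/-- The explicit output of the time-stepping procedure. -/
noncomputable def posterior (p₀ h : State d → ℝ) (t : ℕ → ℝ) (Z : ℝ → ℝ) (n : ℕ) : State d → ℝ :=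
  gibbsDensity p₀ (logLikelihood h (t n) (Z (t n) - Z (t 0)))

lemma isDensity_posterior (hp : IsDensity p₀) (hh : Measurable h) (hH : ∀ x, |h x| ≤ H)
    (ht : IsPartition T N t) {n : ℕ} (hn : n ≤ N) : IsDensity (posterior p₀ h t Z n) :=
  isDensity_gibbsDensity_logLikelihood hp hh hH (ht.mem_Icc hn).1

lemma posterior_zero (hp : IsDensity p₀) (ht : IsPartition T N t) :
    posterior p₀ h t Z 0 = p₀ := by
  have : logLikelihood h (t 0) (Z (t 0) - Z (t 0)) = fun _ => 0 := by
    ext x; simp [logLikelihood, ht.zero]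
  rw [posterior, this, gibbsDensity_zero hp]

lemma posterior_succ (hp : IsDensity p₀) (hh : Measurable h) (hH : ∀ x, |h x| ≤ H)
    (ht : IsPartition T N t) {n : ℕ} (hn : n ≤ N) :
    posterior p₀ h t Z (n + 1) =
      gibbsDensity (posterior p₀ h t Z n)
        (logLikelihood h (increment t n) (increment (Z ∘ t) n)) := by
  rw [posterior, posterior, gibbsDensity_gibbsDensity hp (measurable_logLikelihood hh)
    (le_logLikelihood hH (ht.mem_Icc hn).1) (logLikelihood_le hH (ht.mem_Icc hn).1)]
  congr 1
  ext x
  simp only [logLikelihood, increment, Function.comp_apply]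
  ring

lemma isTimeStepping_posterior (hp : IsDensity p₀) (hh : Measurable h) (hH : ∀ x, |h x| ≤ H)
    (ht : IsPartition T N t) : IsTimeStepping p₀ h N t Z (posterior p₀ h t Z) where
  initial := posterior_zero hp ht
  mem n hn := isDensity_posterior hp hh hH ht hn
  minimizes n hn := by
    refine (forall_objective_le_iff (isDensity_posterior hp hh hH ht hn.le) (EventuallyEq.refl _ _)
      (isDensity_posterior hp hh hH ht hn) hh hH (ht.increment_pos hn)).2 ?_
    rw [posterior_succ hp hh hH ht hn.le]

lemma _root_.IsTimeStepping.ae_eq_posterior {ρ : ℕ → State d → ℝ}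
    (hρ : IsTimeStepping p₀ h N t Z ρ) (hp : IsDensity p₀) (hh : Measurable h)
    (hH : ∀ x, |h x| ≤ H) (ht : IsPartition T N t) {n : ℕ} (hn : n ≤ N) :
    ρ n =ᵐ[volume] posterior p₀ h t Z n := by
  induction n with
  | zero => rw [hρ.initial, posterior_zero hp ht]
  | succ n ih =>
    rw [posterior_succ hp hh hH ht (by omega)]
    exact (forall_objective_le_iff (isDensity_posterior hp hh hH ht (by omega)) (ih (by omega))
      (hρ.mem n hn) hh hH (ht.increment_pos hn)).1 (hρ.minimizes n hn)

end TimeStepping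

end DataAssimilation

namespace DataAssimilation

variable {d : ℕ}

/-! ### Gradients and Hessians -/

section Calculus

variable {F : Type*} [NormedAddCommGroup F] {f g : State d → ℝ}

/-- A set of full measure is dense, and by continuity the set where the bound holds is closed. -/
lemma exists_forall_norm_le_of_memLp_top {u : State d → F} (hc : Continuous u)
    (hu : MemLp u ⊤) : ∃ C, 0 ≤ C ∧ ∀ x, ‖u x‖ ≤ C := by
  refine ⟨(eLpNorm u ⊤ volume).toReal, ENNReal.toReal_nonneg, fun x => ?_⟩
  have hae : ∀ᵐ y, ‖u y‖ ≤ (eLpNorm u ⊤ volume).toReal := by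
    filter_upwards [ae_le_eLpNormEssSup (f := u) (μ := volume)] with y hy
    rw [← eLpNorm_exponent_top] at hy
    simpa using ENNReal.toReal_mono hu.2.ne hy
  have hcl : IsClosed {y | ‖u y‖ ≤ (eLpNorm u ⊤ volume).toReal} :=
    isClosed_le hc.norm continuous_const
  have huniv := (Measure.dense_of_ae hae).closure_eq
  rw [hcl.closure_eq] at huniv
  exact (huniv ▸ mem_univ x : x ∈ {y | ‖u y‖ ≤ (eLpNorm u ⊤ volume).toReal})

lemma gradient_eq_toDual_symm (f : State d → ℝ) :
    gradient f = fun x => (InnerProductSpace.toDual ℝ (State d)).symm (fderiv ℝ f x) := rfl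

lemma norm_gradient_eq (f : State d → ℝ) (x : State d) : ‖gradient f x‖ = ‖fderiv ℝ f x‖ := by
  rw [gradient_eq_toDual_symm, LinearIsometryEquiv.norm_map]

lemma contDiff_gradient (hf : ContDiff ℝ 2 f) : ContDiff ℝ 1 (gradient f) := by
  rw [gradient_eq_toDual_symm]
  exact (InnerProductSpace.toDual ℝ (State d)).symm.contDiff.comp
    (hf.fderiv_right (m := 1) (by norm_num))

lemma continuous_gradient (hf : ContDiff ℝ 1 f) : Continuous (gradient f) := by
  rw [gradient_eq_toDual_symm]
  exact (InnerProductSpace.toDual ℝ (State d)).symm.continuous.comp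
    (hf.continuous_fderiv one_ne_zero)

lemma continuous_hessian (hf : ContDiff ℝ 2 f) : Continuous (hessian f) :=
  (contDiff_gradient hf).continuous_fderiv one_ne_zero

lemma hasFDerivAt_gradient (hf : ContDiff ℝ 2 f) (x : State d) :
    HasFDerivAt (gradient f) (hessian f x) x :=
  ((contDiff_gradient hf).differentiable one_ne_zero x).hasFDerivAt

lemma norm_gradient_le_add_mul (hf : ContDiff ℝ 2 f) {K : ℝ} (hK : ∀ x, ‖hessian f x‖ ≤ K)
    (x : State d) : ‖gradient f x‖ ≤ ‖gradient f 0‖ + K * ‖x‖ := by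
  have h1 := convex_univ.norm_image_sub_le_of_norm_hasFDerivWithin_le
    (fun y _ => (hasFDerivAt_gradient hf y).hasFDerivWithinAt) (fun y _ => hK y)
    (mem_univ 0) (mem_univ x)
  rw [sub_zero] at h1
  linarith [norm_le_norm_add_norm_sub (gradient f 0) (gradient f x),
    norm_sub_rev (gradient f 0) (gradient f x)]

lemma exists_forall_le_norm_of_tendsto {u : State d → F}
    (h : Tendsto (fun x => ‖u x‖) (cocompact (State d)) atTop) (M : ℝ) :
    ∃ R, 0 < R ∧ ∀ x, R ≤ ‖x‖ → M ≤ ‖u x‖ := by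
  have h1 := h.eventually_ge_atTop M
  rw [← Metric.cobounded_eq_cocompact, ← comap_norm_atTop, eventually_comap] at h1
  obtain ⟨R, hR⟩ := (h1.and (eventually_gt_atTop 0)).exists_forall_of_atTop
  exact ⟨R, (hR R le_rfl).2, fun x hx => (hR _ hx).1 x rfl⟩

end Calculus

/-! ### Derivative bounds for the log-likelihood -/

section LogLikelihood

variable {h : State d → ℝ} {τ z A T H H₁ H₂ : ℝ}

lemma contDiff_logLikelihood {n : WithTop ℕ∞} (hh : ContDiff ℝ n h) :
    ContDiff ℝ n (logLikelihood h τ z) := by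
  unfold logLikelihood; fun_prop

lemma hasGradientAt_logLikelihood (hh : ContDiff ℝ 2 h) (x : State d) :
    HasGradientAt (logLikelihood h τ z) ((z - τ * h x) • gradient h x) x := by
  have h1 := (hh.differentiable two_ne_zero x).hasFDerivAt
  rw [hasGradientAt_iff_hasFDerivAt, map_smul, toDual_gradient]
  refine ((h1.const_mul z).sub ((h1.pow 2).const_mul (τ / 2))).congr_fderiv ?_
  ext v
  simp
  ring

lemma gradient_logLikelihood (hh : ContDiff ℝ 2 h) :
    gradient (logLikelihood h τ z) = fun x => (z - τ * h x) • gradient h x :=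
  gradient_eq (hasGradientAt_logLikelihood hh)

lemma abs_sub_mul_le (hH : ∀ x, |h x| ≤ H) (hz : |z| ≤ A) (h0 : 0 ≤ τ)
    (hτ : τ ≤ T) (x : State d) : |z - τ * h x| ≤ A + T * H := by
  calc |z - τ * h x| ≤ |z| + |τ * h x| := abs_sub _ _
    _ ≤ A + T * H := by
      rw [abs_mul, abs_of_nonneg h0]
      exact add_le_add hz (mul_le_mul hτ (hH x) (abs_nonneg _) (h0.trans hτ))

lemma norm_gradient_logLikelihood_le (hh : ContDiff ℝ 2 h) (hH : ∀ x, |h x| ≤ H)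
    (hH₁ : ∀ x, ‖gradient h x‖ ≤ H₁) (hz : |z| ≤ A) (h0 : 0 ≤ τ) (hτ : τ ≤ T) (x : State d) :
    ‖gradient (logLikelihood h τ z) x‖ ≤ (A + T * H) * H₁ := by
  rw [gradient_logLikelihood hh, norm_smul, Real.norm_eq_abs]
  have h1 := abs_sub_mul_le hH hz h0 hτ x
  exact mul_le_mul h1 (hH₁ x) (norm_nonneg _) ((abs_nonneg _).trans h1)

lemma norm_hessian_logLikelihood_le (hh : ContDiff ℝ 2 h) (hH : ∀ x, |h x| ≤ H)
    (hH₁ : ∀ x, ‖gradient h x‖ ≤ H₁) (hH₂ : ∀ x, ‖hessian h x‖ ≤ H₂) (hz : |z| ≤ A)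
    (h0 : 0 ≤ τ) (hτ : τ ≤ T) (x : State d) :
    ‖hessian (logLikelihood h τ z) x‖ ≤ (A + T * H) * H₂ + T * H₁ ^ 2 := by
  -- The Hessian is `(z - τ h) D²h - τ ∇h ⊗ ∇h`; the two summands are bounded separately.
  have h1 : HasFDerivAt (fun x => z - τ * h x) (-(τ • fderiv ℝ h x)) x :=
    (((hh.differentiable two_ne_zero x).hasFDerivAt).const_mul τ).const_sub z
  have h2 := h1.fun_smul (hasFDerivAt_gradient hh x)
  rw [hessian, gradient_logLikelihood hh, HasFDerivAt.fderiv h2]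
  refine (norm_add_le _ _).trans (add_le_add ?_ ?_)
  · rw [norm_smul, Real.norm_eq_abs]
    have h3 := abs_sub_mul_le hH hz h0 hτ x
    exact mul_le_mul h3 (hH₂ x) (norm_nonneg _) ((abs_nonneg _).trans h3)
  · rw [ContinuousLinearMap.norm_smulRight_apply, norm_neg, norm_smul, Real.norm_of_nonneg h0,
      ← norm_gradient_eq, mul_assoc, ← sq]
    exact mul_le_mul hτ (pow_le_pow_left₀ (norm_nonneg _) (hH₁ x) 2) (by positivity)
      (h0.trans hτ)

end LogLikelihood

/-! ### Potentials of the posterior densities -/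

section Potential

variable {h G₀ p₀ : State d → ℝ} {τ z A T H H₁ H₂ K : ℝ}

/-- The potential of the Gibbs density built from `exp (-G₀)` and the log-likelihood. -/
noncomputable def posteriorPotential (G₀ h : State d → ℝ) (τ z c : ℝ) (x : State d) : ℝ :=
  G₀ x - logLikelihood h τ z x + c

lemma gibbsDensity_eq_exp_neg_potential (hp : IsDensity p₀) (hG : ∀ x, p₀ x = Real.exp (-G₀ x))
    (hh : Measurable h) (hH : ∀ x, |h x| ≤ H) (h0 : 0 ≤ τ) (x : State d) :
    gibbsDensity p₀ (logLikelihood h τ z) x = Real.exp (-posteriorPotential G₀ h τ z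
      (Real.log (∫ y, p₀ y * Real.exp (logLikelihood h τ z y))) x) := by
  have hpos := integral_mul_exp_pos hp (measurable_logLikelihood hh) (le_logLikelihood hH h0)
    (logLikelihood_le (ΔZ := z) hH h0)
  rw [gibbsDensity, posteriorPotential, neg_add, Real.exp_add, Real.exp_neg (Real.log _),
    Real.exp_log hpos, hG, ← Real.exp_add, div_eq_mul_inv]
  congr 2
  ring

lemma gibbsDensity_pos (hp : IsDensity p₀) (hG : ∀ x, p₀ x = Real.exp (-G₀ x))
    (hh : Measurable h) (hH : ∀ x, |h x| ≤ H) (h0 : 0 ≤ τ) (x : State d) :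
    0 < gibbsDensity p₀ (logLikelihood h τ z) x := by
  rw [gibbsDensity_eq_exp_neg_potential hp hG hh hH h0]
  exact Real.exp_pos _

variable {c : ℝ}

lemma contDiff_posteriorPotential (hG : ContDiff ℝ 2 G₀) (hh : ContDiff ℝ 2 h) :
    ContDiff ℝ 2 (posteriorPotential G₀ h τ z c) :=
  (hG.sub (contDiff_logLikelihood hh)).add contDiff_const

lemma gradient_posteriorPotential (hG : ContDiff ℝ 2 G₀) (hh : ContDiff ℝ 2 h) :
    gradient (posteriorPotential G₀ h τ z c) =
      fun x => gradient G₀ x - gradient (logLikelihood h τ z) x := by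
  refine gradient_eq fun x => ?_
  rw [hasGradientAt_iff_hasFDerivAt, map_sub, toDual_gradient, toDual_gradient]
  exact (((hG.differentiable two_ne_zero x).hasFDerivAt).sub
    (((contDiff_logLikelihood hh).differentiable two_ne_zero x).hasFDerivAt)).add_const c

lemma hessian_posteriorPotential (hG : ContDiff ℝ 2 G₀) (hh : ContDiff ℝ 2 h) (x : State d) :
    hessian (posteriorPotential G₀ h τ z c) x =
      hessian G₀ x - hessian (logLikelihood h τ z) x := by
  rw [hessian, gradient_posteriorPotential hG hh]
  exact ((hasFDerivAt_gradient hG x).sub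
    (hasFDerivAt_gradient (contDiff_logLikelihood hh) x)).fderiv

end Potential

/-! ### Weak gradients -/

section WeakGradient

variable {f f' : State d → ℝ} {ρ : State d → ℝ}

lemma _root_.HasWeakGradient.congr_ae {g : State d → State d} (hf : HasWeakGradient f g)
    (hff : f =ᵐ[volume] f') : HasWeakGradient f' g where
  locallyIntegrable := hf.locallyIntegrable.congr hff
  locallyIntegrable_grad := hf.locallyIntegrable_grad
  integral_eq φ hφ hc v := by
    rw [← hf.integral_eq φ hφ hc v]
    refine integral_congr_ae ?_
    filter_upwards [hff] with x hx
    rw [hx]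

lemma hasWeakGradient_of_contDiff (hf : ContDiff ℝ 1 f) : HasWeakGradient f (gradient f) where
  locallyIntegrable := hf.continuous.locallyIntegrable
  locallyIntegrable_grad := (continuous_gradient hf).locallyIntegrable
  integral_eq φ hφ hc v := by
    have hcf := hf.continuous_fderiv_apply one_ne_zero
    have hcφ := hφ.continuous_fderiv_apply (by simp)
    have hcv : HasCompactSupport fun x => fderiv ℝ φ x v := hc.fderiv_apply ℝ v
    simp only [inner_gradient_left]
    refine integral_mul_fderiv_eq_neg_fderiv_mul_of_integrable ?_ ?_ ?_
      (fun x _ => hf.differentiable one_ne_zero x) (fun x _ => hφ.differentiable (by simp) x)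
    · exact ((hcf.comp (Continuous.prodMk continuous_id continuous_const)).mul
        hφ.continuous).integrable_of_hasCompactSupport hc.mul_left
    · exact (hf.continuous.mul (hcφ.comp (Continuous.prodMk continuous_id
        continuous_const))).integrable_of_hasCompactSupport hcv.mul_left
    · exact (hf.continuous.mul hφ.continuous).integrable_of_hasCompactSupport hc.mul_left

lemma ae_densityMeasure_of_ae {P : State d → Prop} (h : ∀ᵐ x, P x) :
    ∀ᵐ x ∂densityMeasure ρ, P x :=
  (withDensity_absolutelyContinuous _ _).ae_le h

lemma memH1_of_contDiff_of_bounded (hρ : IsDensity ρ) (hf : ContDiff ℝ 1 f)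
    (hff : f =ᵐ[volume] f') {B B' : ℝ} (hB : ∀ x, ‖f x‖ ≤ B) (hB' : ∀ x, ‖gradient f x‖ ≤ B') :
    MemH1 f' ρ := by
  have := hρ.isProbabilityMeasure
  refine ⟨?_, gradient f, (hasWeakGradient_of_contDiff hf).congr_ae hff, ?_⟩
  · exact (MemLp.of_bound hf.continuous.aestronglyMeasurable B (ae_of_all _ hB)).ae_eq
      (ae_densityMeasure_of_ae hff)
  · exact MemLp.of_bound (continuous_gradient hf).aestronglyMeasurable B' (ae_of_all _ hB')

lemma memH1_exp_div {q : State d → ℝ} (hρ : IsDensity ρ) (hq : ContDiff ℝ 1 q) {b B c : ℝ}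
    (hc : 0 < c) (hb : ∀ x, q x ≤ b) (hB : ∀ x, ‖gradient q x‖ ≤ B)
    (hff : (fun x => Real.exp (q x) / c) =ᵐ[volume] f') : MemH1 f' ρ := by
  have hgrad : gradient (fun x => Real.exp (q x) / c) =
      fun x => (Real.exp (q x) / c) • gradient q x := by
    refine gradient_eq fun x => ?_
    rw [hasGradientAt_iff_hasFDerivAt, map_smul, toDual_gradient]
    simp only [div_eq_inv_mul]
    rw [mul_smul]
    exact ((hq.differentiable one_ne_zero x).hasFDerivAt.exp).const_mul _
  have hbd : ∀ x, ‖Real.exp (q x) / c‖ ≤ Real.exp b / c := fun x => by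
    rw [Real.norm_of_nonneg (by positivity)]
    have := hb x
    gcongr
  refine memH1_of_contDiff_of_bounded (B' := Real.exp b / c * B) hρ (hq.exp.div_const c) hff hbd
    fun x => ?_
  rw [hgrad, norm_smul]
  exact mul_le_mul (hbd x) (hB x) (norm_nonneg _) (by positivity)

end WeakGradient

/-! ### Comparison of density measures -/

section Comparison

variable {F : Type*} [NormedAddCommGroup F] {f : State d → F} {ρ σ : State d → ℝ} {c : ℝ}

lemma _root_.MemL2.mono_density (hf : MemL2 f σ) (hc : 0 ≤ c) (h : ∀ x, ρ x ≤ c * σ x) :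
    MemL2 f ρ :=
  MemLp.of_measure_le_smul ENNReal.ofReal_ne_top (densityMeasure_mono hc h) hf

lemma _root_.MemL2.congr_density (hf : MemL2 f σ) (h : σ =ᵐ[volume] ρ) : MemL2 f ρ := by
  rw [MemL2, ← densityMeasure_congr h]; exact hf

lemma _root_.MemL2.integrable_mul_sq (hρ : IsDensity ρ) (hf : MemL2 f ρ) :
    Integrable fun x => ρ x * ‖f x‖ ^ 2 :=
  (integrable_densityMeasure_iff hρ.measurable hρ.nonneg _).1
    (hf.integrable_norm_pow two_ne_zero)

lemma integral_mul_sq_le (hρ : IsDensity ρ) (hσ : IsDensity σ) (hf : MemL2 f σ) (hc : 0 ≤ c)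
    (h : ∀ x, ρ x ≤ c * σ x) :
    ∫ x, ρ x * ‖f x‖ ^ 2 ≤ c * ∫ x, σ x * ‖f x‖ ^ 2 := by
  rw [← integral_const_mul]
  refine integral_mono ((hf.mono_density hc h).integrable_mul_sq hρ)
    ((hf.integrable_mul_sq hσ).const_mul c) fun x => ?_
  calc ρ x * ‖f x‖ ^ 2 ≤ c * σ x * ‖f x‖ ^ 2 := mul_le_mul_of_nonneg_right (h x) (by positivity)
    _ = _ := by ring

end Comparison

end DataAssimilation

namespace DataAssimilation

variable {d : ℕ}

/-! ### A Poincaré inequality on balls -/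

section LocalPoincare

lemma sq_lintegral_le {Ω : Type*} [MeasurableSpace Ω] {μ : Measure Ω} [IsProbabilityMeasure μ]
    {a : Ω → ℝ≥0∞} (ha : AEMeasurable a μ) : (∫⁻ x, a x ∂μ) ^ 2 ≤ ∫⁻ x, a x ^ 2 ∂μ := by
  have h := ENNReal.lintegral_mul_le_Lp_mul_Lq μ Real.HolderConjugate.two_two ha
    (aemeasurable_const (b := (1 : ℝ≥0∞)))
  simp only [Pi.mul_apply, mul_one, ENNReal.one_rpow, lintegral_one, measure_univ] at h
  calc (∫⁻ x, a x ∂μ) ^ 2 ≤ ((∫⁻ x, a x ^ (2 : ℝ) ∂μ) ^ (1 / 2 : ℝ)) ^ 2 := by gcongr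
    _ = ∫⁻ x, a x ^ 2 ∂μ := by
      rw [← ENNReal.rpow_natCast, ← ENNReal.rpow_mul]
      norm_num

/-- The dilation has Jacobian `s ^ d`, and `s⁻¹ ≤ 2`. -/
lemma lintegral_add_smul_le {Ψ : State d → ℝ≥0∞} (hΨ : Measurable Ψ) (w : State d) {s : ℝ}
    (hs : 1 / 2 ≤ s) : ∫⁻ y, Ψ (w + s • y) ≤ 2 ^ d * ∫⁻ y, Ψ y := by
  have hs0 : 0 < s := by linarith
  have h1 : ∫⁻ y, Ψ (w + s • y) =
      ∫⁻ y, Ψ (w + y) ∂(Measure.map (fun y : State d => s • y) volume) :=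
    (lintegral_map (hΨ.comp (measurable_const_add w)) (measurable_const_smul s)).symm
  rw [h1, Measure.map_addHaar_smul _ hs0.ne', lintegral_smul_measure,
    lintegral_add_left_eq_self Ψ w, smul_eq_mul]
  gcongr
  rw [finrank_euclideanSpace_fin, abs_of_pos (by positivity), ← inv_pow,
    ENNReal.ofReal_pow (by positivity)]
  gcongr
  rw [show (2 : ℝ≥0∞) = ENNReal.ofReal 2 by simp]
  refine ENNReal.ofReal_le_ofReal ?_
  rw [inv_le_comm₀ hs0 two_pos]
  linarith

/-- The fundamental theorem of calculus along the segment, followed by Cauchy–Schwarz in `t`. -/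
lemma enorm_sub_sq_le {φ : State d → ℝ} (hφ : ContDiff ℝ 1 φ) (x y : State d) :
    ‖φ y - φ x‖ₑ ^ 2 ≤
      ‖y - x‖ₑ ^ 2 * ∫⁻ t in Icc (0 : ℝ) 1, ‖fderiv ℝ φ ((1 - t) • x + t • y)‖ₑ ^ 2 := by
  have hc : Continuous fun t : ℝ => fderiv ℝ φ ((1 - t) • x + t • y) :=
    (hφ.continuous_fderiv one_ne_zero).comp (by fun_prop)
  have hγ : ∀ t : ℝ, HasDerivAt (fun t : ℝ => (1 - t) • x + t • y) (y - x) t := fun t => by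
    have h1 := ((hasDerivAt_id t).const_sub 1).smul_const x
    have h2 := (hasDerivAt_id t).smul_const y
    refine (h1.add h2).congr_deriv ?_
    module
  have hd : ∀ t ∈ uIcc (0 : ℝ) 1, HasDerivAt (fun t : ℝ => φ ((1 - t) • x + t • y))
      (fderiv ℝ φ ((1 - t) • x + t • y) (y - x)) t := fun t _ =>
    (hφ.differentiable one_ne_zero _).hasFDerivAt.comp_hasDerivAt t (hγ t)
  have hFTC := intervalIntegral.integral_eq_sub_of_hasDerivAt hd
    ((hc.clm_apply continuous_const).intervalIntegrable 0 1)
  simp only [sub_zero, one_smul, zero_smul, sub_self, add_zero, zero_add] at hFTC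
  have hprob : IsProbabilityMeasure (volume.restrict (Icc (0 : ℝ) 1)) := ⟨by simp⟩
  have hm : Measurable fun t : ℝ => ‖fderiv ℝ φ ((1 - t) • x + t • y)‖ₑ := hc.enorm.measurable
  rw [← hFTC, intervalIntegral.integral_of_le zero_le_one, ← integral_Icc_eq_integral_Ioc]
  calc ‖∫ t in Icc (0 : ℝ) 1, fderiv ℝ φ ((1 - t) • x + t • y) (y - x)‖ₑ ^ 2
      ≤ (∫⁻ t in Icc (0 : ℝ) 1, ‖y - x‖ₑ * ‖fderiv ℝ φ ((1 - t) • x + t • y)‖ₑ) ^ 2 := by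
        gcongr
        refine (enorm_integral_le_lintegral_enorm _).trans (lintegral_mono fun t => ?_)
        rw [mul_comm]
        exact ContinuousLinearMap.le_opENorm _ _
    _ = ‖y - x‖ₑ ^ 2 * (∫⁻ t in Icc (0 : ℝ) 1, ‖fderiv ℝ φ ((1 - t) • x + t • y)‖ₑ) ^ 2 := by
        rw [lintegral_const_mul _ hm, mul_pow]
    _ ≤ _ := by
        gcongr
        exact sq_lintegral_le hm.aemeasurable

/-- One of `t` and `1 - t` is at least `1/2`. With the other endpoint frozen, the map of the
remaining endpoint has bounded inverse Jacobian, and convexity keeps its image in `B`. -/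
lemma lintegral_lintegral_segment_le {Ψ : State d → ℝ≥0∞} (hΨ : Measurable Ψ) {B : Set (State d)}
    (hB : MeasurableSet B) (hconv : Convex ℝ B) {t : ℝ} (ht : t ∈ Icc (0 : ℝ) 1) :
    ∫⁻ x in B, ∫⁻ y in B, Ψ ((1 - t) • x + t • y) ≤
      volume B * (2 ^ d * ∫⁻ x in B, Ψ x) := by
  have key : ∀ s ∈ Icc (1 / 2 : ℝ) 1, ∀ x ∈ B,
      ∫⁻ y in B, Ψ ((1 - s) • x + s • y) ≤ 2 ^ d * ∫⁻ x in B, Ψ x := by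
    intro s hs x hx
    calc ∫⁻ y in B, Ψ ((1 - s) • x + s • y)
        ≤ ∫⁻ y in B, B.indicator Ψ ((1 - s) • x + s • y) := by
          refine setLIntegral_mono' hB fun y hy => ?_
          rw [indicator_of_mem (hconv hx hy (by linarith [hs.2]) (by linarith [hs.1]) (by ring))]
      _ ≤ ∫⁻ y, B.indicator Ψ ((1 - s) • x + s • y) := setLIntegral_le_lintegral _ _
      _ ≤ 2 ^ d * ∫⁻ y, B.indicator Ψ y := lintegral_add_smul_le (hΨ.indicator hB) _ hs.1
      _ = _ := by rw [lintegral_indicator hB]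
  have hmul : ∀ F : State d → ℝ≥0∞, (∀ x ∈ B, F x ≤ 2 ^ d * ∫⁻ x in B, Ψ x) →
      ∫⁻ x in B, F x ≤ volume B * (2 ^ d * ∫⁻ x in B, Ψ x) := fun F hF => by
    refine (setLIntegral_mono' hB hF).trans_eq ?_
    rw [setLIntegral_const, mul_comm]
  rcases le_total (1 / 2) t with h | h
  · exact hmul _ (key t ⟨h, ht.2⟩)
  · rw [lintegral_lintegral_swap (by fun_prop)]
    refine hmul _ fun y hy => ?_
    have := key (1 - t) ⟨by linarith, by linarith [ht.1]⟩ y hy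
    simpa [add_comm] using this

/-- Poincaré inequality for the oscillation of a smooth function on a ball. -/
lemma lintegral_lintegral_sub_sq_closedBall_le {φ : State d → ℝ} (hφ : ContDiff ℝ 1 φ) (R : ℝ) :
    ∫⁻ y in Metric.closedBall (0 : State d) R, ∫⁻ x in Metric.closedBall (0 : State d) R,
        ‖φ x - φ y‖ₑ ^ 2 ≤
      ENNReal.ofReal (2 * R) ^ 2 * (volume (Metric.closedBall (0 : State d) R) *
        (2 ^ d * ∫⁻ x in Metric.closedBall (0 : State d) R, ‖fderiv ℝ φ x‖ₑ ^ 2)) := by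
  set B := Metric.closedBall (0 : State d) R
  have hB : MeasurableSet B := Metric.isClosed_closedBall.measurableSet
  have hΨ : Measurable fun x => ‖fderiv ℝ φ x‖ₑ ^ 2 :=
    ((hφ.continuous_fderiv one_ne_zero).enorm.measurable).pow_const 2
  have hdist : ∀ x ∈ B, ∀ y ∈ B, ‖y - x‖ₑ ≤ ENNReal.ofReal (2 * R) := fun x hx y hy => by
    rw [← ofReal_norm]
    refine ENNReal.ofReal_le_ofReal ((norm_sub_le _ _).trans ?_)
    linarith [mem_closedBall_zero_iff.1 hx, mem_closedBall_zero_iff.1 hy]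
  calc ∫⁻ y in B, ∫⁻ x in B, ‖φ x - φ y‖ₑ ^ 2
      ≤ ∫⁻ y in B, ∫⁻ x in B, ENNReal.ofReal (2 * R) ^ 2 *
          ∫⁻ t in Icc (0 : ℝ) 1, ‖fderiv ℝ φ ((1 - t) • y + t • x)‖ₑ ^ 2 := by
        refine setLIntegral_mono' hB fun y hy => setLIntegral_mono' hB fun x hx => ?_
        refine (enorm_sub_sq_le hφ y x).trans ?_
        gcongr
        exact hdist y hy x hx
    _ = ENNReal.ofReal (2 * R) ^ 2 * ∫⁻ y in B, ∫⁻ x in B,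
          ∫⁻ t in Icc (0 : ℝ) 1, ‖fderiv ℝ φ ((1 - t) • y + t • x)‖ₑ ^ 2 := by
        simp_rw [lintegral_const_mul' _ _ (ENNReal.pow_ne_top ENNReal.ofReal_ne_top)]
    -- Tonelli moves `t` outermost, so that the segment estimate applies for each fixed `t`.
    _ = ENNReal.ofReal (2 * R) ^ 2 * ∫⁻ t in Icc (0 : ℝ) 1, ∫⁻ y in B, ∫⁻ x in B,
          ‖fderiv ℝ φ ((1 - t) • y + t • x)‖ₑ ^ 2 := by
        congr 1
        have hswap : ∀ y : State d, ∫⁻ x in B, ∫⁻ t in Icc (0 : ℝ) 1,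
            ‖fderiv ℝ φ ((1 - t) • y + t • x)‖ₑ ^ 2 = ∫⁻ t in Icc (0 : ℝ) 1, ∫⁻ x in B,
            ‖fderiv ℝ φ ((1 - t) • y + t • x)‖ₑ ^ 2 := fun y =>
          lintegral_lintegral_swap (hΨ.comp (f := fun p : State d × ℝ =>
            (1 - p.2) • y + p.2 • p.1) (by fun_prop)).aemeasurable
        simp_rw [hswap]
        refine lintegral_lintegral_swap (Measurable.aemeasurable ?_)
        exact Measurable.lintegral_prod_right' (hΨ.comp (f := fun p : (State d × ℝ) × State d =>
          (1 - p.1.2) • p.1.1 + p.1.2 • p.2) (by fun_prop))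
    _ ≤ ENNReal.ofReal (2 * R) ^ 2 * ∫⁻ t in Icc (0 : ℝ) 1,
          (volume B * (2 ^ d * ∫⁻ x in B, ‖fderiv ℝ φ x‖ₑ ^ 2)) := by
        gcongr 1
        exact setLIntegral_mono' measurableSet_Icc fun t ht =>
          lintegral_lintegral_segment_le hΨ hB (convex_closedBall 0 R) ht
    _ = _ := by rw [setLIntegral_const, Real.volume_Icc]; simp

end LocalPoincare

/-! ### Lyapunov-type inequality for `exp (-G)` -/

section Lyapunov

variable {G ρ : State d → ℝ} {K : ℝ}

/-- The second moment is finite, and `(1 + r)² ≤ 2(1 + r²)`. -/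
lemma _root_.IsDensity.integrable_mul_of_quadratic_growth (hρ : IsDensity ρ) {u : State d → ℝ}
    (hu : Continuous u) {c : ℝ} (hc : ∀ x, |u x| ≤ c * (1 + ‖x‖) ^ 2) :
    Integrable fun x => u x * ρ x := by
  have hc0 : 0 ≤ c := by simpa using (abs_nonneg _).trans (hc 0)
  refine ((hρ.integrable.add hρ.second_moment).const_mul (2 * c)).mono'
    (hu.measurable.mul hρ.measurable).aestronglyMeasurable (ae_of_all _ fun x => ?_)
  rw [norm_mul, Real.norm_of_nonneg (hρ.nonneg x), Real.norm_eq_abs]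
  calc |u x| * ρ x ≤ (c * (1 + ‖x‖) ^ 2) * ρ x :=
        mul_le_mul_of_nonneg_right (hc x) (hρ.nonneg x)
    _ ≤ (c * (2 * (1 + ‖x‖ ^ 2))) * ρ x := by
        refine mul_le_mul_of_nonneg_right (mul_le_mul_of_nonneg_left ?_ hc0) (hρ.nonneg x)
        nlinarith [sq_nonneg (1 - ‖x‖)]
    _ = 2 * c * (ρ x + ‖x‖ ^ 2 * ρ x) := by ring

/-- Since `∂ᵥρ = -(∂ᵥG) ρ`, integrating `ψ² ∂ᵥG` against `∂ᵥρ` by parts turns the left side into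
`∫(ψ² ∂ᵥ∂ᵥG + 2ψ ∂ᵥψ ∂ᵥG) ρ`. The Hessian bound handles the first term and Young's inequality the
second. The linear growth of `∇G` and the second moment of `ρ` make every integral finite, so the
absorption is legitimate. -/
lemma integral_sq_mul_inner_gradient_sq_le (hρ : IsDensity ρ) (hG : ∀ x, ρ x = Real.exp (-G x))
    (hG2 : ContDiff ℝ 2 G) (hK : ∀ x, ‖hessian G x‖ ≤ K) {ψ : State d → ℝ}
    (hψ : ContDiff ℝ 1 ψ) {b : ℝ} (hb : ∀ x, |ψ x| ≤ b) (hb' : ∀ x, ‖gradient ψ x‖ ≤ b)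
    {v : State d} (hv : ‖v‖ = 1) :
    Integrable (fun x => (inner ℝ (gradient G x) v) ^ 2 * ψ x ^ 2 * ρ x) ∧
    ∫ x, (inner ℝ (gradient G x) v) ^ 2 * ψ x ^ 2 * ρ x ≤
      4 * (∫ x, (inner ℝ (gradient ψ x) v) ^ 2 * ρ x) + 2 * K * ∫ x, ψ x ^ 2 * ρ x := by
  have hb0 : 0 ≤ b := (abs_nonneg _).trans (hb 0)
  have hK0 : 0 ≤ K := (norm_nonneg _).trans (hK 0)
  set D : State d → ℝ := fun x => inner ℝ (gradient G x) v with hD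
  set P : State d → ℝ := fun x => inner ℝ (gradient ψ x) v with hP
  set E : State d → ℝ := fun x => inner ℝ (hessian G x v) v with hE
  have hDc : Continuous D := (contDiff_gradient hG2).continuous.inner continuous_const
  have hPc : Continuous P := (continuous_gradient hψ).inner continuous_const
  have hEc : Continuous E :=
    ((continuous_hessian hG2).clm_apply continuous_const).inner continuous_const
  have hψc := hψ.continuous
  have hρc : Continuous ρ := by
    rw [show ρ = fun x => Real.exp (-G x) from funext hG]
    exact Real.continuous_exp.comp hG2.continuous.neg
  obtain ⟨L, hL0, hL⟩ : ∃ L, 0 ≤ L ∧ ∀ x, |D x| ≤ L * (1 + ‖x‖) := by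
    refine ⟨‖gradient G 0‖ + K, by positivity, fun x => ?_⟩
    have h1 := norm_gradient_le_add_mul hG2 hK x
    have h2 : |D x| ≤ ‖gradient G x‖ :=
      (abs_real_inner_le_norm (gradient G x) v).trans_eq (by rw [hv, mul_one])
    nlinarith [norm_nonneg x, norm_nonneg (gradient G 0), mul_nonneg (norm_nonneg x)
      (norm_nonneg (gradient G 0))]
  have hPb : ∀ x, |P x| ≤ b := fun x => by
    have h2 : |P x| ≤ ‖gradient ψ x‖ :=
      (abs_real_inner_le_norm (gradient ψ x) v).trans_eq (by rw [hv, mul_one])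
    exact h2.trans (hb' x)
  have hEb : ∀ x, |E x| ≤ K := fun x => by
    have h2 : |E x| ≤ ‖hessian G x v‖ :=
      (abs_real_inner_le_norm (hessian G x v) v).trans_eq (by rw [hv, mul_one])
    have h3 := (hessian G x).le_opNorm v
    rw [hv, mul_one] at h3
    exact h2.trans (h3.trans (hK x))
  have hDd : ∀ x, HasFDerivAt D ((innerSL ℝ v).comp (hessian G x)) x := fun x => by
    rw [show D = fun x => innerSL ℝ v (gradient G x) from funext fun x => real_inner_comm _ _]
    exact (innerSL ℝ v).hasFDerivAt.comp x (hasFDerivAt_gradient hG2 x)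
  have hone : ∀ x : State d, 1 ≤ 1 + ‖x‖ := fun x => by linarith [norm_nonneg x]
  have hfd : ∀ x, HasFDerivAt (fun x => ψ x ^ 2 * D x)
      (ψ x ^ 2 • ((innerSL ℝ v).comp (hessian G x)) +
        D x • ((2 * ψ x) • fderiv ℝ ψ x)) x := fun x => by
    have h1 := ((hψ.differentiable one_ne_zero x).hasFDerivAt.pow 2).mul (hDd x)
    refine h1.congr_fderiv ?_
    ext w
    simp
  have hfv : ∀ x, fderiv ℝ (fun x => ψ x ^ 2 * D x) x v = ψ x ^ 2 * E x + 2 * ψ x * P x * D x :=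
    fun x => by
      rw [(hfd x).fderiv]
      simp [hE, hP, real_inner_comm]
      ring
  have hρd : ∀ x, HasFDerivAt ρ (ρ x • -fderiv ℝ G x) x := fun x => by
    rw [hG x, show ρ = fun x => Real.exp (-G x) from funext hG]
    exact (hG2.differentiable two_ne_zero x).hasFDerivAt.neg.exp
  have hρv : ∀ x, fderiv ℝ ρ x v = -(D x * ρ x) := fun x => by
    rw [(hρd x).fderiv]
    simp [hD]
    ring
  have hψ2 : ∀ x, ψ x ^ 2 ≤ b ^ 2 := fun x => sq_le_sq' (by linarith [neg_abs_le (ψ x), hb x])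
    ((le_abs_self _).trans (hb x))
  have hD2 : ∀ x, D x ^ 2 ≤ (L * (1 + ‖x‖)) ^ 2 := fun x =>
    sq_le_sq' (by linarith [neg_abs_le (D x), hL x]) ((le_abs_self _).trans (hL x))
  have hP2 : ∀ x, P x ^ 2 ≤ b ^ 2 := fun x => sq_le_sq' (by linarith [neg_abs_le (P x), hPb x])
    ((le_abs_self _).trans (hPb x))
  have hone2 : ∀ x : State d, 1 ≤ (1 + ‖x‖) ^ 2 := fun x => one_le_pow₀ (hone x)
  have i1 : Integrable fun x => D x ^ 2 * ψ x ^ 2 * ρ x := by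
    refine hρ.integrable_mul_of_quadratic_growth (c := L ^ 2 * b ^ 2) (by fun_prop) fun x => ?_
    rw [abs_of_nonneg (by positivity)]
    calc D x ^ 2 * ψ x ^ 2 ≤ (L * (1 + ‖x‖)) ^ 2 * b ^ 2 :=
          mul_le_mul (hD2 x) (hψ2 x) (by positivity) (by positivity)
      _ = _ := by ring
  have i2 : Integrable fun x => (ψ x ^ 2 * E x) * ρ x := by
    refine hρ.integrable_mul_of_quadratic_growth (c := b ^ 2 * K) (by fun_prop) fun x => ?_
    rw [abs_mul, abs_of_nonneg (by positivity : 0 ≤ ψ x ^ 2)]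
    calc ψ x ^ 2 * |E x| ≤ b ^ 2 * K :=
          mul_le_mul (hψ2 x) (hEb x) (by positivity) (by positivity)
      _ ≤ _ := le_mul_of_one_le_right (by positivity) (hone2 x)
  have i3 : Integrable fun x => (2 * ψ x * P x * D x) * ρ x := by
    refine hρ.integrable_mul_of_quadratic_growth (c := 2 * b * b * L) (by fun_prop) fun x => ?_
    rw [abs_mul, abs_mul, abs_mul, abs_two]
    calc 2 * |ψ x| * |P x| * |D x| ≤ 2 * b * b * (L * (1 + ‖x‖)) := by
          gcongr
          · exact hb x
          · exact hPb x
          · exact hL x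
      _ ≤ 2 * b * b * (L * (1 + ‖x‖) ^ 2) := by
          gcongr
          exact le_self_pow₀ (hone x) two_ne_zero
      _ = _ := by ring
  have i4 : Integrable fun x => (ψ x ^ 2 * D x) * ρ x := by
    refine hρ.integrable_mul_of_quadratic_growth (c := b ^ 2 * L) (by fun_prop) fun x => ?_
    rw [abs_mul, abs_of_nonneg (by positivity : 0 ≤ ψ x ^ 2)]
    calc ψ x ^ 2 * |D x| ≤ b ^ 2 * (L * (1 + ‖x‖)) :=
          mul_le_mul (hψ2 x) (hL x) (by positivity) (by positivity)
      _ ≤ b ^ 2 * (L * (1 + ‖x‖) ^ 2) := by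
          gcongr
          exact le_self_pow₀ (hone x) two_ne_zero
      _ = _ := by ring
  have i5 : Integrable fun x => P x ^ 2 * ρ x := by
    refine hρ.integrable_mul_of_quadratic_growth (c := b ^ 2) (by fun_prop) fun x => ?_
    rw [abs_of_nonneg (by positivity)]
    exact (hP2 x).trans (le_mul_of_one_le_right (by positivity) (hone2 x))
  have i6 : Integrable fun x => ψ x ^ 2 * ρ x := by
    refine hρ.integrable_mul_of_quadratic_growth (c := b ^ 2) (by fun_prop) fun x => ?_
    rw [abs_of_nonneg (by positivity)]
    exact (hψ2 x).trans (le_mul_of_one_le_right (by positivity) (hone2 x))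
  have hIBP := integral_mul_fderiv_eq_neg_fderiv_mul_of_integrable (μ := volume) (v := v)
    (f := fun x => ψ x ^ 2 * D x) (g := ρ)
    (by simp_rw [hfv, add_mul]; exact i2.add i3)
    (by simp_rw [hρv]; exact i1.neg.congr (ae_of_all _ fun x => by simp; ring))
    i4 (fun x _ => (hfd x).differentiableAt) (fun x _ => (hρd x).differentiableAt)
  have hIBP' : ∫ x, D x ^ 2 * ψ x ^ 2 * ρ x =
      ∫ x, (ψ x ^ 2 * E x + 2 * ψ x * P x * D x) * ρ x := by
    simp_rw [hfv, hρv] at hIBP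
    rw [← neg_inj, ← hIBP, ← integral_neg]
    exact integral_congr_ae (ae_of_all _ fun x => by simp only; ring)
  refine ⟨i1, ?_⟩
  have i7 : Integrable fun x => 2 * (P x ^ 2 * ρ x) + 1 / 2 * (D x ^ 2 * ψ x ^ 2 * ρ x) :=
    (i5.const_mul 2).add (i1.const_mul (1 / 2))
  have hmono : ∫ x, (ψ x ^ 2 * E x + 2 * ψ x * P x * D x) * ρ x ≤
      ∫ x, (K * (ψ x ^ 2 * ρ x) + (2 * (P x ^ 2 * ρ x) +
        1 / 2 * (D x ^ 2 * ψ x ^ 2 * ρ x))) := by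
    refine integral_mono (by simp_rw [add_mul]; exact i2.add i3)
      ((i6.const_mul K).add i7) fun x => ?_
    have h1 : ψ x ^ 2 * E x ≤ ψ x ^ 2 * K :=
      mul_le_mul_of_nonneg_left ((le_abs_self _).trans (hEb x)) (by positivity)
    -- Weights chosen so that half of the left side is absorbed; doubling afterwards produces the
    -- constants `4` and `2K`.
    have h2 : 2 * ψ x * P x * D x ≤ 2 * P x ^ 2 + 1 / 2 * (D x ^ 2 * ψ x ^ 2) := by
      nlinarith [sq_nonneg (2 * P x - D x * ψ x)]
    have h3 := mul_le_mul_of_nonneg_right (add_le_add h1 h2) (hρ.nonneg x)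
    simp only
    linarith
  rw [integral_add (i6.const_mul K) i7,
    integral_add (i5.const_mul 2) (i1.const_mul (1 / 2)), integral_const_mul,
    integral_const_mul, integral_const_mul, ← hIBP'] at hmono
  change ∫ x, D x ^ 2 * ψ x ^ 2 * ρ x ≤ 4 * (∫ x, P x ^ 2 * ρ x) + 2 * K * ∫ x, ψ x ^ 2 * ρ x
  linarith

lemma sum_sq_inner_single (w : State d) :
    ∑ i, (inner ℝ w (EuclideanSpace.single i (1 : ℝ))) ^ 2 = ‖w‖ ^ 2 := by
  simp [EuclideanSpace.norm_sq_eq, EuclideanSpace.inner_single_right]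

/-- Summing the directional estimate over an orthonormal basis costs `2dK ∫ψ²ρ`. Outside the ball
`|∇G|²` exceeds `2dK` by at least one, which leaves a full `∫ψ²ρ` there; inside, the deficit is paid
by the last term. -/
lemma integral_sq_mul_le (hρ : IsDensity ρ) (hG : ∀ x, ρ x = Real.exp (-G x))
    (hG2 : ContDiff ℝ 2 G) (hK : ∀ x, ‖hessian G x‖ ≤ K) {R : ℝ}
    (hR : ∀ x, R ≤ ‖x‖ → 2 * d * K + 1 ≤ ‖gradient G x‖ ^ 2) {ψ : State d → ℝ}
    (hψ : ContDiff ℝ 1 ψ) {b : ℝ} (hb : ∀ x, |ψ x| ≤ b) (hb' : ∀ x, ‖gradient ψ x‖ ≤ b) :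
    ∫ x, ψ x ^ 2 * ρ x ≤ 4 * (∫ x, ‖gradient ψ x‖ ^ 2 * ρ x) +
      (1 + 2 * d * K) * ∫ x in Metric.closedBall (0 : State d) R, ψ x ^ 2 * ρ x := by
  have hb0 : 0 ≤ b := (abs_nonneg _).trans (hb 0)
  have hK0 : 0 ≤ K := (norm_nonneg _).trans (hK 0)
  have hone2 : ∀ x : State d, 1 ≤ (1 + ‖x‖) ^ 2 := fun x =>
    one_le_pow₀ (by linarith [norm_nonneg x])
  have hψc := hψ.continuous
  have hgc := continuous_gradient hψ
  have hB : MeasurableSet (Metric.closedBall (0 : State d) R) :=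
    Metric.isClosed_closedBall.measurableSet
  have hcomp := fun i => integral_sq_mul_inner_gradient_sq_le hρ hG hG2 hK hψ hb hb'
    (v := EuclideanSpace.single i (1 : ℝ)) (by simp)
  have hψint : Integrable fun x => ψ x ^ 2 * ρ x := by
    refine hρ.integrable_mul_of_quadratic_growth (c := b ^ 2) (by fun_prop) fun x => ?_
    rw [abs_of_nonneg (by positivity), ← sq_abs]
    exact (pow_le_pow_left₀ (abs_nonneg _) (hb x) 2).trans
      (le_mul_of_one_le_right (by positivity) (hone2 x))
  have hpint : ∀ i, Integrable fun x =>
      (inner ℝ (gradient ψ x) (EuclideanSpace.single i (1 : ℝ))) ^ 2 * ρ x := fun i => by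
    refine hρ.integrable_mul_of_quadratic_growth (c := b ^ 2)
      ((hgc.inner continuous_const).pow 2) fun x => ?_
    rw [abs_of_nonneg (by positivity), ← sq_abs]
    refine (pow_le_pow_left₀ (abs_nonneg _) ((abs_real_inner_le_norm _ _).trans ?_) 2).trans
      (le_mul_of_one_le_right (by positivity) (hone2 x))
    simpa using hb' x
  have hsumint : Integrable fun x => ‖gradient G x‖ ^ 2 * ψ x ^ 2 * ρ x := by
    simp_rw [← sum_sq_inner_single, Finset.sum_mul]
    exact integrable_finsetSum _ fun i _ => (hcomp i).1
  have hsum : ∫ x, ‖gradient G x‖ ^ 2 * ψ x ^ 2 * ρ x ≤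
      4 * (∫ x, ‖gradient ψ x‖ ^ 2 * ρ x) + 2 * d * K * ∫ x, ψ x ^ 2 * ρ x := by
    simp_rw [← sum_sq_inner_single, Finset.sum_mul]
    rw [integral_finsetSum _ fun i _ => (hcomp i).1, integral_finsetSum _ fun i _ => hpint i]
    refine (Finset.sum_le_sum fun i _ => (hcomp i).2).trans_eq ?_
    rw [Finset.sum_add_distrib, Finset.mul_sum, Finset.sum_const, Finset.card_univ,
      Fintype.card_fin, nsmul_eq_mul]
    ring
  have hpt : (∫ x, ψ x ^ 2 * ρ x) + ∫ x, 2 * d * K * (ψ x ^ 2 * ρ x) ≤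
      (∫ x, ‖gradient G x‖ ^ 2 * ψ x ^ 2 * ρ x) +
        ∫ x, (Metric.closedBall (0 : State d) R).indicator
          (fun x => (1 + 2 * d * K) * (ψ x ^ 2 * ρ x)) x := by
    rw [← integral_add hψint (hψint.const_mul _),
      ← integral_add hsumint ((hψint.const_mul _).indicator hB)]
    refine integral_mono (hψint.add (hψint.const_mul _))
      (hsumint.add ((hψint.const_mul _).indicator hB)) fun x => ?_
    have hnn : 0 ≤ ψ x ^ 2 * ρ x := mul_nonneg (by positivity) (hρ.nonneg x)
    by_cases hx : x ∈ Metric.closedBall (0 : State d) R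
    · simp only [indicator_of_mem hx]
      nlinarith [mul_nonneg (sq_nonneg ‖gradient G x‖) hnn]
    · simp only [indicator_of_notMem hx]
      have := hR x (by simpa using (not_le.1 (mt mem_closedBall_zero_iff.2 hx)).le)
      nlinarith [mul_le_mul_of_nonneg_right this hnn]
  rw [integral_indicator hB, integral_const_mul, integral_const_mul] at hpt
  linarith

end Lyapunov

/-! ### Poincaré inequality for smooth functions -/

section Smooth

/-- The energy `∬ |f x - f y|² dμ dμ` of the differences of `f`. -/
noncomputable def differenceEnergy (μ : Measure (State d)) (f : State d → ℝ) : ℝ≥0∞ :=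
  ∫⁻ y, ∫⁻ x, ‖f x - f y‖ₑ ^ 2 ∂μ ∂μ

lemma ennreal_add_sq_le (a b : ℝ≥0∞) : (a + b) ^ 2 ≤ 2 * a ^ 2 + 2 * b ^ 2 := by
  have h := ENNReal.rpow_add_le_mul_rpow_add_rpow a b one_le_two
  norm_num at h
  rwa [mul_add] at h

lemma differenceEnergy_le (μ : Measure (State d)) [IsProbabilityMeasure μ] {f : State d → ℝ}
    (hf : Measurable f) (c : ℝ) :
    differenceEnergy μ f ≤ 4 * ∫⁻ x, ‖f x - c‖ₑ ^ 2 ∂μ := by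
  have hm : Measurable fun x => 2 * ‖f x - c‖ₑ ^ 2 := by fun_prop
  calc differenceEnergy μ f
      ≤ ∫⁻ y, ∫⁻ x, (2 * ‖f x - c‖ₑ ^ 2 + 2 * ‖f y - c‖ₑ ^ 2) ∂μ ∂μ := by
        refine lintegral_mono fun y => lintegral_mono fun x => ?_
        refine le_trans ?_ (ennreal_add_sq_le _ _)
        gcongr
        rw [show f x - f y = (f x - c) - (f y - c) by ring]
        exact enorm_sub_le
    _ = 4 * ∫⁻ x, ‖f x - c‖ₑ ^ 2 ∂μ := by
        simp_rw [lintegral_add_left hm, lintegral_const, measure_univ, mul_one]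
        rw [lintegral_add_left measurable_const, lintegral_const, measure_univ, mul_one,
          lintegral_const_mul _ (by fun_prop), ← add_mul]
        norm_num

variable {G ρ : State d → ℝ} {K : ℝ}

lemma lintegral_enorm_sq_densityMeasure {F : Type*} [NormedAddCommGroup F] (hρ : IsDensity ρ)
    {f : State d → F} (hf : Integrable fun x => ‖f x‖ ^ 2 * ρ x) :
    ∫⁻ x, ‖f x‖ₑ ^ 2 ∂densityMeasure ρ = ENNReal.ofReal (∫ x, ‖f x‖ ^ 2 * ρ x) := by
  rw [lintegral_densityMeasure hρ.measurable, ofReal_integral_eq_lintegral_ofReal hf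
    (ae_of_all _ fun x => mul_nonneg (by positivity) (hρ.nonneg x))]
  refine lintegral_congr fun x => ?_
  rw [ENNReal.ofReal_mul (by positivity), ENNReal.ofReal_pow (norm_nonneg _), ofReal_norm,
    mul_comm]

/-- The Lyapunov estimate for `φ - c` leaves an integral over the ball `B`. Instead of taking `c` to
be a mean, one takes `c = φ y` and averages over `y ∈ B`: the remainder becomes the oscillation
integral on the ball. -/
lemma exists_differenceEnergy_le_of_contDiff (hρ : IsDensity ρ)
    (hG : ∀ x, ρ x = Real.exp (-G x)) (hG2 : ContDiff ℝ 2 G) (hK : ∀ x, ‖hessian G x‖ ≤ K)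
    (hlim : Tendsto (fun x => ‖gradient G x‖) (cocompact (State d)) atTop) :
    ∃ A : ℝ≥0∞, A ≠ ⊤ ∧ ∀ φ : State d → ℝ, ContDiff ℝ 1 φ → HasCompactSupport φ →
      differenceEnergy (densityMeasure ρ) φ ≤
        A * ∫⁻ x, ‖gradient φ x‖ₑ ^ 2 ∂densityMeasure ρ := by
  have hK0 : 0 ≤ K := (norm_nonneg _).trans (hK 0)
  have := hρ.isProbabilityMeasure
  obtain ⟨R, hR0, hR⟩ := exists_forall_le_norm_of_tendsto hlim (2 * d * K + 1)
  have hR' : ∀ x, R ≤ ‖x‖ → 2 * d * K + 1 ≤ ‖gradient G x‖ ^ 2 := fun x hx => by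
    have h1 : 0 ≤ 2 * d * K := by positivity
    exact (hR x hx).trans (le_self_pow₀ (by linarith [hR x hx]) two_ne_zero)
  set B := Metric.closedBall (0 : State d) R
  have hB : MeasurableSet B := Metric.isClosed_closedBall.measurableSet
  have hBpos : volume B ≠ 0 := (Metric.measure_closedBall_pos _ _ hR0).ne'
  have hBtop : volume B ≠ ⊤ := measure_closedBall_lt_top.ne
  obtain ⟨C, hC⟩ := (isCompact_closedBall (0 : State d) R).exists_bound_of_continuousOn
    hG2.continuous.continuousOn
  have hρle : ∀ x ∈ B, ρ x ≤ Real.exp C := fun x hx => by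
    rw [hG]
    exact Real.exp_le_exp.2 ((neg_le_abs _).trans (hC x hx))
  have hleρ : ∀ x ∈ B, 1 ≤ Real.exp C * ρ x := fun x hx => by
    rw [hG, ← Real.exp_add]
    exact Real.one_le_exp (by linarith [(le_abs_self (G x)).trans (hC x hx)])
  set E : ℝ≥0∞ := ENNReal.ofReal (Real.exp C)
  set k : ℝ≥0∞ := ENNReal.ofReal (1 + 2 * d * K)
  set S : ℝ≥0∞ := ENNReal.ofReal (2 * R) ^ 2
  -- One factor `E` bounds `ρ` from above on the ball, the other from below; `S * 2 ^ d` is the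
  -- constant of the ball inequality.
  refine ⟨16 + 4 * k * E * S * 2 ^ d * E, ?_, fun φ hφ hφc => ?_⟩
  · finiteness
  set I := ∫⁻ x, ‖gradient φ x‖ₑ ^ 2 ∂densityMeasure ρ
  obtain ⟨b₁, hb₁⟩ := hφc.exists_bound_of_continuous hφ.continuous
  obtain ⟨b₂, hb₂⟩ := (hφc.fderiv ℝ).exists_bound_of_continuous (hφ.continuous_fderiv one_ne_zero)
  have hgc := continuous_gradient hφ
  -- `φ - c` need not have compact support, but it is bounded with bounded gradient, as the Lyapunov
  -- estimate requires.
  have hconst : ∀ c : ℝ, ∫⁻ x, ‖φ x - c‖ₑ ^ 2 ∂densityMeasure ρ ≤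
      4 * I + k * (E * ∫⁻ x in B, ‖φ x - c‖ₑ ^ 2) := by
    intro c
    have hψ : ContDiff ℝ 1 fun x => φ x - c := hφ.sub contDiff_const
    have hgrad : gradient (fun x => φ x - c) = gradient φ := by
      simp_rw [gradient_eq_toDual_symm, fderiv_sub_const]
    have hb : ∀ x, |φ x - c| ≤ b₁ + |c| + b₂ := fun x => by
      linarith [abs_sub (φ x) c, hb₁ x, Real.norm_eq_abs (φ x), (norm_nonneg _).trans (hb₂ x)]
    have hb' : ∀ x, ‖gradient (fun x => φ x - c) x‖ ≤ b₁ + |c| + b₂ := fun x => by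
      rw [hgrad, norm_gradient_eq]
      linarith [abs_nonneg c, hb₂ x, (norm_nonneg _).trans (hb₁ x)]
    have hb0 : 0 ≤ b₁ + |c| + b₂ := (abs_nonneg _).trans (hb 0)
    have hone2 : ∀ x : State d, 1 ≤ (1 + ‖x‖) ^ 2 := fun x =>
      one_le_pow₀ (by linarith [norm_nonneg x])
    have i1 : Integrable fun x => ‖φ x - c‖ ^ 2 * ρ x := by
      refine hρ.integrable_mul_of_quadratic_growth (c := (b₁ + |c| + b₂) ^ 2)
        (hψ.continuous.norm.pow 2) fun x => ?_
      rw [abs_of_nonneg (by positivity)]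
      exact (pow_le_pow_left₀ (norm_nonneg _) (hb x) 2).trans
        (le_mul_of_one_le_right (by positivity) (hone2 x))
    have i2 : Integrable fun x => ‖gradient φ x‖ ^ 2 * ρ x := by
      refine hρ.integrable_mul_of_quadratic_growth (c := (b₁ + |c| + b₂) ^ 2)
        (hgc.norm.pow 2) fun x => ?_
      rw [abs_of_nonneg (by positivity)]
      exact (pow_le_pow_left₀ (norm_nonneg _) (hgrad ▸ hb' x) 2).trans
        (le_mul_of_one_le_right (by positivity) (hone2 x))
    have hreal := integral_sq_mul_le hρ hG hG2 hK hR' hψ hb hb'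
    rw [hgrad] at hreal
    simp_rw [← sq_abs (φ _ - c), ← Real.norm_eq_abs] at hreal
    rw [lintegral_enorm_sq_densityMeasure hρ i1]
    refine (ENNReal.ofReal_le_ofReal hreal).trans ?_
    have hi0 : 0 ≤ ∫ x, ‖gradient φ x‖ ^ 2 * ρ x :=
      integral_nonneg fun x => mul_nonneg (by positivity) (hρ.nonneg x)
    have hj0 : ∀ x, 0 ≤ ‖φ x - c‖ ^ 2 * ρ x := fun x => mul_nonneg (by positivity) (hρ.nonneg x)
    rw [ENNReal.ofReal_add (by positivity)
      (mul_nonneg (by positivity) (integral_nonneg hj0)),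
      ENNReal.ofReal_mul (by norm_num), ENNReal.ofReal_mul (by positivity),
      ← lintegral_enorm_sq_densityMeasure hρ i2,
      ofReal_integral_eq_lintegral_ofReal i1.integrableOn (ae_of_all _ hj0),
      ← lintegral_const_mul' E _ ENNReal.ofReal_ne_top]
    gcongr ?_ + k * ?_
    · simp [I]
    · refine setLIntegral_mono' hB fun x hx => ?_
      rw [ENNReal.ofReal_mul (by positivity), ENNReal.ofReal_pow (norm_nonneg _), ofReal_norm,
        mul_comm]
      gcongr
      exact ENNReal.ofReal_le_ofReal (hρle x hx)
  have hball : ∫⁻ x in B, ‖fderiv ℝ φ x‖ₑ ^ 2 ≤ E * I := by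
    rw [← lintegral_const_mul' _ _ ENNReal.ofReal_ne_top,
      lintegral_densityMeasure hρ.measurable]
    refine (setLIntegral_mono' hB fun x hx => ?_).trans (setLIntegral_le_lintegral B _)
    rw [mul_left_comm, ← mul_assoc, ← ENNReal.ofReal_mul (Real.exp_nonneg C), ← ofReal_norm,
      ← ofReal_norm, norm_gradient_eq]
    refine le_mul_of_one_le_left zero_le ?_
    exact ENNReal.one_le_ofReal.2 (hleρ x hx)
  have hosc := lintegral_lintegral_sub_sq_closedBall_le hφ R
  have hV : ∀ c : ℝ, differenceEnergy (densityMeasure ρ) φ ≤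
      16 * I + 4 * k * E * ∫⁻ x in B, ‖φ x - c‖ₑ ^ 2 := fun c => by
    refine (differenceEnergy_le _ hφ.continuous.measurable c).trans ?_
    calc 4 * ∫⁻ x, ‖φ x - c‖ₑ ^ 2 ∂densityMeasure ρ
        ≤ 4 * (4 * I + k * (E * ∫⁻ x in B, ‖φ x - c‖ₑ ^ 2)) := by gcongr; exact hconst c
      _ = _ := by ring
  -- Multiplying by the volume of `B` expresses the average over `y ∈ B`.
  refine (ENNReal.mul_le_mul_iff_left hBpos hBtop).1 ?_
  calc differenceEnergy (densityMeasure ρ) φ * volume B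
      = ∫⁻ _ in B, differenceEnergy (densityMeasure ρ) φ := (setLIntegral_const _ _).symm
    _ ≤ ∫⁻ y in B, (16 * I + 4 * k * E * ∫⁻ x in B, ‖φ x - φ y‖ₑ ^ 2) :=
        lintegral_mono fun y => hV (φ y)
    _ = 16 * I * volume B + 4 * k * E * ∫⁻ y in B, ∫⁻ x in B, ‖φ x - φ y‖ₑ ^ 2 := by
        rw [lintegral_add_left measurable_const, setLIntegral_const,
          lintegral_const_mul' _ _ (by finiteness)]
    _ ≤ 16 * I * volume B + 4 * k * E * (S * (volume B * (2 ^ d * (E * I)))) := by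
        gcongr
        refine hosc.trans ?_
        gcongr
    _ = _ := by ring

end Smooth

end DataAssimilation

namespace DataAssimilation

variable {d : ℕ}

/-! ### Mollification of weakly differentiable functions -/

section Mollification

open scoped Convolution

variable {f : State d → ℝ} {g : State d → State d} {η : State d → ℝ}

/-- Convolution of `f` with the kernel `η`. -/
noncomputable def mollify (η f : State d → ℝ) : State d → ℝ :=
  f ⋆[(ContinuousLinearMap.lsmul ℝ ℝ).flip, volume] η

lemma mollify_eq (η f : State d → ℝ) :
    mollify η f = η ⋆[ContinuousLinearMap.lsmul ℝ ℝ, volume] f :=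
  convolution_flip _

lemma contDiff_mollify (hf : LocallyIntegrable f) (hη : ContDiff ℝ ∞ η)
    (hηc : HasCompactSupport η) : ContDiff ℝ 1 (mollify η f) :=
  HasCompactSupport.contDiff_convolution_right (n := 1) _ hηc hf (hη.of_le (by norm_cast))

lemma hasCompactSupport_mollify (hf : HasCompactSupport f) (hηc : HasCompactSupport η) :
    HasCompactSupport (mollify η f) := hf.convolution _ hηc

/-- The weak gradient is tested against `t ↦ η (x - t)`; the sign from the reflection cancels the
one in the definition. -/
lemma gradient_mollify (hfg : HasWeakGradient f g) (hη : ContDiff ℝ ∞ η)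
    (hηc : HasCompactSupport η) (x : State d) :
    gradient (mollify η f) x = ∫ t, η (x - t) • g t := by
  have hη1 : ContDiff ℝ 1 η := hη.of_le (by norm_cast)
  have hsub : HasCompactSupport fun t => η (x - t) :=
    hηc.comp_homeomorph (Homeomorph.subLeft x)
  have hint : Integrable fun t => η (x - t) • g t :=
    hfg.locallyIntegrable_grad.integrable_smul_left_of_hasCompactSupport
      (hη.continuous.comp (continuous_const.sub continuous_id)) hsub
  refine ext_inner_right ℝ fun v => ?_
  have hd := hηc.hasFDerivAt_convolution_right (μ := volume)
    (ContinuousLinearMap.lsmul ℝ ℝ).flip hfg.locallyIntegrable hη1 x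
  rw [inner_gradient_left, mollify, hd.fderiv, convolution_precompR_apply _ hfg.locallyIntegrable
    (hηc.fderiv ℝ) (hη1.continuous_fderiv one_ne_zero), convolution_def]
  have htest := hfg.integral_eq (fun t => η (x - t)) (hη.comp (contDiff_const.sub contDiff_id))
    hsub v
  have hder : ∀ t, fderiv ℝ (fun t => η (x - t)) t v = -(fderiv ℝ η (x - t) v) := fun t => by
    have h1 : HasFDerivAt (fun t => η (x - t))
        ((fderiv ℝ η (x - t)).comp (-ContinuousLinearMap.id ℝ (State d))) t :=
      (hη1.differentiable one_ne_zero (x - t)).hasFDerivAt.comp t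
        ((hasFDerivAt_id t).const_sub x)
    rw [h1.fderiv]
    simp
  simp_rw [hder, mul_neg, integral_neg, neg_inj] at htest
  calc ∫ t, (ContinuousLinearMap.lsmul ℝ ℝ).flip (f t) (fderiv ℝ η (x - t) v)
      = ∫ t, f t * fderiv ℝ η (x - t) v := by
        refine integral_congr_ae (ae_of_all _ fun t => ?_)
        simp [mul_comm]
    _ = ∫ t, inner ℝ v (η (x - t) • g t) := by
        rw [htest]
        refine integral_congr_ae (ae_of_all _ fun t => ?_)
        simp only [inner_smul_right, real_inner_comm v]
        ring
    _ = inner ℝ v (∫ t, η (x - t) • g t) := (innerSL ℝ v).integral_comp_comm hint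
    _ = _ := real_inner_comm _ _

variable {ρ : State d → ℝ}

/-- Jensen's inequality for the probability density `η (x - ·)`, then Tonelli. The hypothesis
`hcomp` moves the weight from `x` to `t` at the price of the factor `2`. -/
lemma lintegral_gradient_mollify_le (hfg : HasWeakGradient f g) (hη : ContDiff ℝ ∞ η)
    (hηc : HasCompactSupport η) (h0 : ∀ x, 0 ≤ η x) (h1 : ∫ x, η x = 1) (hρ : Measurable ρ)
    (hcomp : ∀ t, g t ≠ 0 → ∀ x, η (x - t) ≠ 0 → ρ x ≤ 2 * ρ t) :
    ∫⁻ x, ‖gradient (mollify η f) x‖ₑ ^ 2 ∂densityMeasure ρ ≤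
      2 * ∫⁻ x, ‖g x‖ₑ ^ 2 ∂densityMeasure ρ := by
  have hηint : Integrable η := hη.continuous.integrable_of_hasCompactSupport hηc
  have hηm : Measurable η := hη.continuous.measurable
  have hηL : ∫⁻ x, ENNReal.ofReal (η x) = 1 := by
    rw [← ofReal_integral_eq_lintegral_ofReal hηint (ae_of_all _ h0), h1, ENNReal.ofReal_one]
  have hgm : AEStronglyMeasurable g volume := hfg.locallyIntegrable_grad.aestronglyMeasurable
  have hpt : ∀ x, ‖gradient (mollify η f) x‖ₑ ^ 2 ≤
      ∫⁻ t, ENNReal.ofReal (η (x - t)) * ‖g t‖ₑ ^ 2 := fun x => by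
    have hm : Measurable fun t => η (x - t) := hηm.comp (measurable_const.sub measurable_id)
    have hprob : IsProbabilityMeasure (densityMeasure fun t => η (x - t)) := by
      constructor
      rw [densityMeasure, withDensity_apply _ MeasurableSet.univ, Measure.restrict_univ,
        lintegral_sub_left_eq_self fun t => ENNReal.ofReal (η t)]
      exact hηL
    have hmono : ‖gradient (mollify η f) x‖ₑ ≤
        ∫⁻ t, ‖g t‖ₑ ∂densityMeasure fun t => η (x - t) := by
      rw [gradient_mollify hfg hη hηc, lintegral_densityMeasure hm]
      refine (enorm_integral_le_lintegral_enorm _).trans_eq (lintegral_congr fun t => ?_)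
      rw [enorm_smul, Real.enorm_eq_ofReal (h0 _)]
    rw [← lintegral_densityMeasure hm]
    calc ‖gradient (mollify η f) x‖ₑ ^ 2
        ≤ (∫⁻ t, ‖g t‖ₑ ∂densityMeasure fun t => η (x - t)) ^ 2 := by gcongr
      _ ≤ _ := sq_lintegral_le
          (hgm.enorm.mono_ac (withDensity_absolutelyContinuous _ _))
  calc ∫⁻ x, ‖gradient (mollify η f) x‖ₑ ^ 2 ∂densityMeasure ρ
      ≤ ∫⁻ x, ∫⁻ t, ENNReal.ofReal (ρ x) * (ENNReal.ofReal (η (x - t)) * ‖g t‖ₑ ^ 2) := by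
        rw [lintegral_densityMeasure hρ]
        refine lintegral_mono fun x => ?_
        rw [lintegral_const_mul' _ _ ENNReal.ofReal_ne_top]
        gcongr
        exact hpt x
    _ = ∫⁻ t, ∫⁻ x, ENNReal.ofReal (ρ x) * (ENNReal.ofReal (η (x - t)) * ‖g t‖ₑ ^ 2) := by
        refine lintegral_lintegral_swap ?_
        refine AEMeasurable.mul (f := fun p : State d × State d => ENNReal.ofReal (ρ p.1))
          (by fun_prop) (AEMeasurable.mul
          (f := fun p : State d × State d => ENNReal.ofReal (η (p.1 - p.2)))
          (g := fun p : State d × State d => ‖g p.2‖ₑ ^ 2) ?_ ?_)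
        · exact (hηm.comp (measurable_fst.sub measurable_snd)).ennreal_ofReal.aemeasurable
        · exact (AEMeasurable.comp_snd hgm.enorm).pow_const 2
    _ ≤ ∫⁻ t, ∫⁻ x, (2 * (ENNReal.ofReal (ρ t) * ‖g t‖ₑ ^ 2)) * ENNReal.ofReal (η (x - t)) := by
        refine lintegral_mono fun t => lintegral_mono fun x => ?_
        by_cases hgt : g t = 0
        · simp [hgt]
        by_cases hηt : η (x - t) = 0
        · simp [hηt]
        calc ENNReal.ofReal (ρ x) * (ENNReal.ofReal (η (x - t)) * ‖g t‖ₑ ^ 2)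
            ≤ ENNReal.ofReal (2 * ρ t) * (ENNReal.ofReal (η (x - t)) * ‖g t‖ₑ ^ 2) := by
              gcongr
              exact hcomp t hgt x hηt
          _ = _ := by rw [ENNReal.ofReal_mul two_pos.le, ENNReal.ofReal_ofNat]; ring
    _ = 2 * ∫⁻ x, ‖g x‖ₑ ^ 2 ∂densityMeasure ρ := by
        rw [lintegral_densityMeasure hρ, ← lintegral_const_mul' _ _ ENNReal.ofNat_ne_top]
        refine lintegral_congr fun t => ?_
        have hm : Measurable fun x => ENNReal.ofReal (η (x - t)) := by fun_prop
        rw [lintegral_const_mul _ hm,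
          lintegral_sub_right_eq_self (fun t => ENNReal.ofReal (η t)) t, hηL, mul_one]

end Mollification

/-! ### Lower semicontinuity of the difference energy -/

section LowerSemicontinuity

variable {μ : Measure (State d)}

/-- Fatou's lemma, for the inner and then for the outer integral. -/
lemma differenceEnergy_le_of_tendsto [SFinite μ] {F : ℕ → State d → ℝ} {f : State d → ℝ}
    {b : ℕ → ℝ≥0∞} {B : ℝ≥0∞} (hm : ∀ k, AEMeasurable (F k) μ)
    (hlim : ∀ᵐ x ∂μ, Tendsto (fun k => F k x) atTop (nhds (f x)))
    (hb : ∀ᶠ k in atTop, differenceEnergy μ (F k) ≤ b k) (hB : Tendsto b atTop (nhds B)) :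
    differenceEnergy μ f ≤ B := by
  have hm2 : ∀ k, AEMeasurable (fun p : State d × State d => ‖F k p.2 - F k p.1‖ₑ ^ 2)
      (μ.prod μ) := fun k => (((hm k).comp_snd.sub (hm k).comp_fst).enorm).pow_const 2
  calc differenceEnergy μ f
      = ∫⁻ y, ∫⁻ x, liminf (fun k => ‖F k x - F k y‖ₑ ^ 2) atTop ∂μ ∂μ := by
        refine lintegral_congr_ae ?_
        filter_upwards [hlim] with y hy
        refine lintegral_congr_ae ?_
        filter_upwards [hlim] with x hx
        exact ((ENNReal.continuous_pow 2).tendsto _ |>.comp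
          ((continuous_enorm.tendsto _).comp (hx.sub hy))).liminf_eq.symm
    _ ≤ ∫⁻ y, liminf (fun k => ∫⁻ x, ‖F k x - F k y‖ₑ ^ 2 ∂μ) atTop ∂μ :=
        lintegral_mono fun y => lintegral_liminf_le' fun k =>
          (((hm k).sub_const _).enorm).pow_const 2
    _ ≤ liminf (fun k => differenceEnergy μ (F k)) atTop :=
        lintegral_liminf_le' fun k => (hm2 k).lintegral_prod_right'
    _ ≤ liminf b atTop := liminf_le_liminf hb
    _ = B := hB.liminf_eq

lemma differenceEnergy_mono {ν : Measure (State d)} {c : ℝ≥0∞} (hc : c ≠ ⊤) (h : μ ≤ c • ν)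
    (f : State d → ℝ) : differenceEnergy μ f ≤ c * (c * differenceEnergy ν f) := by
  calc differenceEnergy μ f ≤ ∫⁻ y, ∫⁻ x, ‖f x - f y‖ₑ ^ 2 ∂(c • ν) ∂(c • ν) :=
        lintegral_mono' h fun y => lintegral_mono' h fun x => le_rfl
    _ = _ := by
      simp_rw [lintegral_smul_measure, smul_eq_mul, lintegral_const_mul' c _ hc]
      rfl

end LowerSemicontinuity

/-! ### Cutoff -/

section Cutoff

variable {f : State d → ℝ} {g : State d → State d} {χ : State d → ℝ}

/-- The product rule, obtained by testing the weak gradient of `f` against `χ φ`. -/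
lemma _root_.HasWeakGradient.mul_cutoff (hfg : HasWeakGradient f g) (hχ : ContDiff ℝ ∞ χ)
    (hχc : HasCompactSupport χ) :
    HasWeakGradient (fun x => χ x * f x) (fun x => χ x • g x + f x • gradient χ x) := by
  have hχ1 : ContDiff ℝ 1 χ := hχ.of_le (by norm_cast)
  have hgχ : Continuous (gradient χ) := continuous_gradient hχ1
  have hgχc : HasCompactSupport (gradient χ) := by
    rw [gradient_eq_toDual_symm]
    exact (hχc.fderiv ℝ).comp_left (map_zero _)
  have hfgrad : Integrable fun x => f x • gradient χ x :=
    hfg.locallyIntegrable.integrable_smul_right_of_hasCompactSupport hgχ hgχc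
  refine ⟨(hfg.locallyIntegrable.integrable_smul_left_of_hasCompactSupport
      hχ.continuous hχc).locallyIntegrable,
    ((hfg.locallyIntegrable_grad.integrable_smul_left_of_hasCompactSupport
      hχ.continuous hχc).add hfgrad).locallyIntegrable, fun φ hφ hφc v => ?_⟩
  have hφ1 : ContDiff ℝ 1 φ := hφ.of_le (by norm_cast)
  have htest := hfg.integral_eq (fun x => χ x * φ x) (hχ.mul hφ) hφc.mul_left v
  have hder : ∀ x, fderiv ℝ (fun x => χ x * φ x) x v =
      χ x * fderiv ℝ φ x v + φ x * fderiv ℝ χ x v := fun x => by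
    rw [fderiv_fun_mul (hχ1.differentiable one_ne_zero x) (hφ1.differentiable one_ne_zero x)]
    simp
  have hφv : Continuous fun x => fderiv ℝ φ x v :=
    (hφ1.continuous_fderiv one_ne_zero).clm_apply continuous_const
  have hχv : Continuous fun x => fderiv ℝ χ x v :=
    (hχ1.continuous_fderiv one_ne_zero).clm_apply continuous_const
  have i1 : Integrable fun x => f x * (χ x * fderiv ℝ φ x v) :=
    hfg.locallyIntegrable.integrable_smul_right_of_hasCompactSupport
      (hχ.continuous.mul hφv) hχc.mul_right
  have i2 : Integrable fun x => f x * (φ x * fderiv ℝ χ x v) :=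
    hfg.locallyIntegrable.integrable_smul_right_of_hasCompactSupport
      (hφ.continuous.mul hχv) hφc.mul_right
  have i3 : Integrable fun x => inner ℝ (g x) v * (χ x * φ x) := by
    have h := (hfg.locallyIntegrable_grad.integrable_smul_left_of_hasCompactSupport
      (hχ.continuous.mul hφ.continuous) hφc.mul_left).inner_const (𝕜 := ℝ) v
    refine h.congr (ae_of_all _ fun x => ?_)
    simp only [inner_smul_left, conj_trivial, Pi.mul_apply]
    ring
  simp_rw [hder, mul_add] at htest
  rw [integral_add i1 i2] at htest
  have e1 : ∫ x, χ x * f x * fderiv ℝ φ x v = ∫ x, f x * (χ x * fderiv ℝ φ x v) :=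
    integral_congr_ae (ae_of_all _ fun x => by simp only; ring)
  have e2 : ∫ x, inner ℝ (χ x • g x + f x • gradient χ x) v * φ x =
      (∫ x, inner ℝ (g x) v * (χ x * φ x)) + ∫ x, f x * (φ x * fderiv ℝ χ x v) := by
    rw [← integral_add i3 i2]
    refine integral_congr_ae (ae_of_all _ fun x => ?_)
    simp only [inner_add_left, inner_smul_left, conj_trivial, inner_gradient_left]
    ring
  rw [e1, e2]
  linarith

/-- Smooth cutoff functions, equal to one on large balls and with small gradients. -/
lemma exists_cutoff (d : ℕ) : ∃ (χ : ℕ → State d → ℝ) (c : ℝ), 0 ≤ c ∧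
    (∀ k, ContDiff ℝ ∞ (χ k)) ∧ (∀ k, HasCompactSupport (χ k)) ∧
    (∀ k x, |χ k x| ≤ 1) ∧ (∀ k x, ‖gradient (χ k) x‖ ≤ c / (k + 1)) ∧
    ∀ x, Tendsto (fun k => χ k x) atTop (nhds 1) := by
  -- Dilates `β (x / (k + 1))` of one bump: the chain rule gives the decay `c / (k + 1)`.
  let β : ContDiffBump (0 : State d) := ⟨1, 2, one_pos, one_lt_two⟩
  have hβ1 : ContDiff ℝ 1 β := β.contDiff
  obtain ⟨c, hc⟩ := (β.hasCompactSupport.fderiv ℝ).exists_bound_of_continuous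
    (hβ1.continuous_fderiv one_ne_zero)
  have hk : ∀ k : ℕ, (0 : ℝ) < (k + 1 : ℝ)⁻¹ := fun k => by positivity
  refine ⟨fun k x => β ((k + 1 : ℝ)⁻¹ • x), c, (norm_nonneg _).trans (hc 0),
    fun k => β.contDiff.comp (contDiff_const_smul _), fun k => ?_, fun k x => ?_, fun k x => ?_,
    fun x => ?_⟩
  · exact β.hasCompactSupport.comp_smul (hk k).ne'
  · rw [abs_of_nonneg β.nonneg]
    exact β.le_one
  · have h1 : HasFDerivAt (fun x => β ((k + 1 : ℝ)⁻¹ • x))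
        ((fderiv ℝ β ((k + 1 : ℝ)⁻¹ • x)).comp
          ((k + 1 : ℝ)⁻¹ • ContinuousLinearMap.id ℝ (State d))) x :=
      (hβ1.differentiable one_ne_zero _).hasFDerivAt.comp x
        ((hasFDerivAt_id x).const_smul ((k + 1 : ℝ)⁻¹))
    rw [norm_gradient_eq, h1.fderiv, ContinuousLinearMap.comp_smul,
      ContinuousLinearMap.comp_id, norm_smul, Real.norm_of_nonneg (hk k).le, div_eq_inv_mul]
    exact mul_le_mul_of_nonneg_left (hc _) (hk k).le
  · refine tendsto_const_nhds.congr' ?_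
    filter_upwards [eventually_ge_atTop ⌈‖x‖⌉₊] with k hkx
    refine (β.one_of_mem_closedBall ?_).symm
    rw [mem_closedBall_zero_iff, norm_smul, Real.norm_of_nonneg (hk k).le]
    change _ ≤ (1 : ℝ)
    rw [inv_mul_le_one₀ (by positivity)]
    have h2 : (⌈‖x‖⌉₊ : ℝ) ≤ k := by exact_mod_cast hkx
    linarith [Nat.le_ceil ‖x‖]

end Cutoff

end DataAssimilation

namespace DataAssimilation

variable {d : ℕ}

/-! ### Poincaré inequality for weakly differentiable functions -/

section Poincare

variable {f G ρ : State d → ℝ} {g : State d → State d} {A : ℝ≥0∞}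

/-- `G` is uniformly continuous near a compact set, and an oscillation below `log 2` changes `exp
(-G)` by a factor of at most `2`. -/
lemma exists_radius_exp_neg_le (hG : ∀ x, ρ x = Real.exp (-G x)) (hGc : Continuous G)
    {S : Set (State d)} (hS : IsCompact S) :
    ∃ r > 0, ∀ t ∈ S, ∀ x, ‖x - t‖ < r → ρ x ≤ 2 * ρ t := by
  have h := hS.uniformContinuousAt_of_continuousAt G (fun a _ => hGc.continuousAt)
    (Metric.dist_mem_uniformity (Real.log_pos one_lt_two))
  obtain ⟨r, hr, hr'⟩ := Metric.mem_uniformity_dist.1 h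
  refine ⟨r, hr, fun t ht x hx => ?_⟩
  have h1 : dist (G t) (G x) < Real.log 2 :=
    hr' (by rwa [dist_comm, dist_eq_norm]) ht
  have h2 : (2 : ℝ) * Real.exp (-G t) = Real.exp (Real.log 2 + -G t) := by
    rw [Real.exp_add, Real.exp_log two_pos]
  rw [hG, hG, h2]
  refine Real.exp_le_exp.2 ?_
  linarith [(abs_lt.1 (Real.dist_eq _ _ ▸ h1)).2]

lemma differenceEnergy_le_of_hasCompactSupport (hρ : IsDensity ρ)
    (hG : ∀ x, ρ x = Real.exp (-G x)) (hGc : Continuous G)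
    (hsmooth : ∀ φ : State d → ℝ, ContDiff ℝ 1 φ → HasCompactSupport φ →
      differenceEnergy (densityMeasure ρ) φ ≤
        A * ∫⁻ x, ‖gradient φ x‖ₑ ^ 2 ∂densityMeasure ρ)
    (hfg : HasWeakGradient f g) (hf : HasCompactSupport f) (hg : HasCompactSupport g) :
    differenceEnergy (densityMeasure ρ) f ≤
      A * (2 * ∫⁻ x, ‖g x‖ₑ ^ 2 ∂densityMeasure ρ) := by
  have := hρ.isProbabilityMeasure
  obtain ⟨r, hr, hr'⟩ := exists_radius_exp_neg_le hG hGc hg.isCompact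
  have hδ : ∀ k : ℕ, 0 < r / 2 / (k + 1) := fun k => by positivity
  -- Outer radii stay below `r`, the scale on which `ρ` at most doubles. The fixed ratio `2` of the
  -- radii is what a.e. convergence of the mollifications asks for.
  let β : ℕ → ContDiffBump (0 : State d) := fun k =>
    ⟨r / 2 / (k + 1), 2 * (r / 2 / (k + 1)), hδ k, by linarith [hδ k]⟩
  have hβlim : Tendsto (fun k => (β k).rOut) atTop (nhds 0) := by
    have h1 : Tendsto (fun k : ℕ => 2 * (r / 2 / ((k : ℝ) + 1))) atTop (nhds (2 * 0)) :=
      (tendsto_const_nhds.div_atTop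
        (tendsto_natCast_atTop_atTop.atTop_add tendsto_const_nhds)).const_mul 2
    rwa [mul_zero] at h1
  have hβle : ∀ k, (β k).rOut ≤ r := fun k => by
    change 2 * (r / 2 / ((k : ℝ) + 1)) ≤ r
    have h1 : r / 2 / ((k : ℝ) + 1) ≤ r / 2 :=
      div_le_self (by positivity) (by linarith [(Nat.cast_nonneg k : (0 : ℝ) ≤ k)])
    linarith
  have hlim : ∀ᵐ x, Tendsto (fun k => mollify ((β k).normed volume) f x) atTop (nhds (f x)) := by
    simp_rw [mollify_eq]
    exact ContDiffBump.ae_convolution_tendsto_right_of_locallyIntegrable (K := 2) hβlim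
      (Eventually.of_forall fun k => le_rfl) hfg.locallyIntegrable
  refine differenceEnergy_le_of_tendsto
    (F := fun k => mollify ((β k).normed volume) f)
    (b := fun _ => A * (2 * ∫⁻ x, ‖g x‖ₑ ^ 2 ∂densityMeasure ρ)) (fun k => ?_)
    (ae_densityMeasure_of_ae hlim) (Eventually.of_forall fun k => ?_) tendsto_const_nhds
  · exact (contDiff_mollify hfg.locallyIntegrable (β k).contDiff_normed
      (β k).hasCompactSupport_normed).continuous.measurable.aemeasurable
  · refine (hsmooth _ (contDiff_mollify hfg.locallyIntegrable (β k).contDiff_normed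
      (β k).hasCompactSupport_normed) (hasCompactSupport_mollify hf
      (β k).hasCompactSupport_normed)).trans ?_
    gcongr
    refine lintegral_gradient_mollify_le hfg (β k).contDiff_normed
      (β k).hasCompactSupport_normed (β k).nonneg_normed (β k).integral_normed hρ.measurable
      fun t ht x hx => hr' t (subset_tsupport g ht) x ?_
    have h1 : x - t ∈ Function.support ((β k).normed volume) := hx
    rw [(β k).support_normed_eq, mem_ball_zero_iff] at h1
    exact h1.trans_le (hβle k)

/-- Truncation by `χ k` adds `f ∇χ k` to the gradient, which vanishes in the limit because `f` is
square integrable. The factor `4` is `2` from mollification times `2` from squaring a sum. -/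
lemma differenceEnergy_le_of_hasWeakGradient (hρ : IsDensity ρ)
    (hG : ∀ x, ρ x = Real.exp (-G x)) (hGc : Continuous G) (hA : A ≠ ⊤)
    (hsmooth : ∀ φ : State d → ℝ, ContDiff ℝ 1 φ → HasCompactSupport φ →
      differenceEnergy (densityMeasure ρ) φ ≤
        A * ∫⁻ x, ‖gradient φ x‖ₑ ^ 2 ∂densityMeasure ρ)
    (hfg : HasWeakGradient f g) (hf : MemL2 f ρ) :
    differenceEnergy (densityMeasure ρ) f ≤
      4 * A * ∫⁻ x, ‖g x‖ₑ ^ 2 ∂densityMeasure ρ := by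
  have := hρ.isProbabilityMeasure
  obtain ⟨χ, c, hc, hχ, hχc, hχ1, hχg, hχlim⟩ := exists_cutoff d
  set I := ∫⁻ x, ‖g x‖ₑ ^ 2 ∂densityMeasure ρ
  set J := ∫⁻ x, ‖f x‖ₑ ^ 2 ∂densityMeasure ρ
  have hJ : J ≠ ⊤ := by
    have h1 := hf.eLpNorm_lt_top
    rw [eLpNorm_lt_top_iff_lintegral_rpow_enorm_lt_top two_ne_zero ENNReal.ofNat_ne_top] at h1
    simpa [J] using h1.ne
  have hgm : AEStronglyMeasurable g (densityMeasure ρ) :=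
    hfg.locallyIntegrable_grad.aestronglyMeasurable.mono_ac (withDensity_absolutelyContinuous _ _)
  have hε : Tendsto (fun k : ℕ => ENNReal.ofReal (c / (k + 1)) ^ 2) atTop (nhds 0) := by
    have h1 : Tendsto (fun k : ℕ => c / ((k : ℝ) + 1)) atTop (nhds 0) :=
      tendsto_const_nhds.div_atTop
        (tendsto_natCast_atTop_atTop.atTop_add tendsto_const_nhds)
    have h2 := (ENNReal.continuous_pow 2).tendsto _ |>.comp (ENNReal.tendsto_ofReal h1)
    simpa [Function.comp_def] using h2
  have hgk : ∀ k, ∫⁻ x, ‖χ k x • g x + f x • gradient (χ k) x‖ₑ ^ 2 ∂densityMeasure ρ ≤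
      2 * I + 2 * (ENNReal.ofReal (c / (k + 1)) ^ 2 * J) := fun k => by
    calc ∫⁻ x, ‖χ k x • g x + f x • gradient (χ k) x‖ₑ ^ 2 ∂densityMeasure ρ
        ≤ ∫⁻ x, (2 * ‖g x‖ₑ ^ 2 +
            2 * (ENNReal.ofReal (c / (k + 1)) ^ 2 * ‖f x‖ₑ ^ 2)) ∂densityMeasure ρ := by
          refine lintegral_mono fun x => ?_
          have h1 : ‖χ k x • g x‖ₑ ≤ ‖g x‖ₑ := by
            rw [enorm_smul]
            refine mul_le_of_le_one_left zero_le ?_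
            rw [Real.enorm_eq_ofReal_abs]
            exact ENNReal.ofReal_le_one.2 (hχ1 k x)
          have h2 : ‖f x • gradient (χ k) x‖ₑ ≤ ENNReal.ofReal (c / (k + 1)) * ‖f x‖ₑ := by
            rw [enorm_smul, mul_comm]
            gcongr
            rw [← ofReal_norm]
            exact ENNReal.ofReal_le_ofReal (hχg k x)
          calc ‖χ k x • g x + f x • gradient (χ k) x‖ₑ ^ 2
              ≤ (‖g x‖ₑ + ENNReal.ofReal (c / (k + 1)) * ‖f x‖ₑ) ^ 2 := by
                gcongr
                exact (enorm_add_le _ _).trans (add_le_add h1 h2)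
            _ ≤ _ := (ennreal_add_sq_le _ _).trans_eq (by rw [mul_pow])
      _ = _ := by
          rw [lintegral_add_left' ((hgm.enorm.pow_const 2).const_mul 2),
            lintegral_const_mul' _ _ ENNReal.ofNat_ne_top,
            lintegral_const_mul' _ _ ENNReal.ofNat_ne_top,
            lintegral_const_mul' _ _ (by finiteness)]
  refine differenceEnergy_le_of_tendsto (F := fun k x => χ k x * f x)
    (b := fun k => A * (2 * (2 * I + 2 * (ENNReal.ofReal (c / (k + 1)) ^ 2 * J))))
    (fun k => ?_) (ae_of_all _ fun x => ?_) (Eventually.of_forall fun k => ?_) ?_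
  · exact (hχ k).continuous.measurable.aemeasurable.mul hf.aestronglyMeasurable.aemeasurable
  · simpa using (hχlim x).mul_const (f x)
  · have hgrad : HasCompactSupport (gradient (χ k)) := by
      rw [gradient_eq_toDual_symm]
      exact ((hχc k).fderiv ℝ).comp_left (map_zero _)
    have h1 : HasCompactSupport fun x => χ k x * f x := (hχc k).mul_right
    have h2 : HasCompactSupport fun x => χ k x • g x := (hχc k).mono fun x hx h0 => hx (by simp [h0])
    have h3 : HasCompactSupport fun x => f x • gradient (χ k) x :=
      hgrad.mono fun x hx h0 => hx (by simp [h0])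
    refine (differenceEnergy_le_of_hasCompactSupport hρ hG hGc hsmooth
      (hfg.mul_cutoff (hχ k) (hχc k)) h1 (h2.add h3)).trans ?_
    have h4 := hgk k
    gcongr
  · have h1 : Tendsto (fun k : ℕ => ENNReal.ofReal (c / (k + 1)) ^ 2 * J) atTop (nhds 0) := by
      simpa using ENNReal.Tendsto.mul_const hε (Or.inr hJ)
    have h2 : Tendsto (fun k : ℕ => 2 * I + 2 * (ENNReal.ofReal (c / (k + 1)) ^ 2 * J)) atTop
        (nhds (2 * I + 2 * 0)) :=
      tendsto_const_nhds.add (ENNReal.Tendsto.const_mul h1 (Or.inr ENNReal.ofNat_ne_top))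
    have h3 := ENNReal.Tendsto.const_mul (a := A)
      (ENNReal.Tendsto.const_mul (a := 2) h2 (Or.inr ENNReal.ofNat_ne_top)) (Or.inr hA)
    rw [show 4 * A * I = A * (2 * (2 * I + 2 * 0)) by ring]
    exact h3

/-- The negative exponential of a `C²` potential with bounded Hessian and with gradient tending to
infinity controls the difference energy of weakly differentiable functions. -/
lemma exists_differenceEnergy_le {K : ℝ} (hρ : IsDensity ρ)
    (hG : ∀ x, ρ x = Real.exp (-G x)) (hG2 : ContDiff ℝ 2 G) (hK : ∀ x, ‖hessian G x‖ ≤ K)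
    (hlim : Tendsto (fun x => ‖gradient G x‖) (cocompact (State d)) atTop) :
    ∃ A : ℝ≥0∞, A ≠ ⊤ ∧ ∀ (f : State d → ℝ) (g : State d → State d),
      HasWeakGradient f g → MemL2 f ρ → differenceEnergy (densityMeasure ρ) f ≤
        A * ∫⁻ x, ‖g x‖ₑ ^ 2 ∂densityMeasure ρ := by
  obtain ⟨A, hA, hA'⟩ := exists_differenceEnergy_le_of_contDiff hρ hG hG2 hK hlim
  exact ⟨4 * A, by finiteness, fun f g hfg hf =>
    differenceEnergy_le_of_hasWeakGradient hρ hG hG2.continuous hA hA' hfg hf⟩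

lemma _root_.MemL2.lintegral_enorm_sq_eq {F : Type*} [NormedAddCommGroup F] {u : State d → F}
    (hρ : IsDensity ρ) (hu : MemL2 u ρ) :
    ∫⁻ x, ‖u x‖ₑ ^ 2 ∂densityMeasure ρ = ENNReal.ofReal (∫ x, ‖u x‖ ^ 2 * ρ x) :=
  lintegral_enorm_sq_densityMeasure hρ
    ((hu.integrable_mul_sq hρ).congr (ae_of_all _ fun _ => mul_comm _ _))

/-- For mean zero, `c ↦ ∫|f - c|²ρ` is smallest at `c = 0`; take `c = f y` and average over `y`. -/
lemma lintegral_enorm_sq_le_differenceEnergy (hρ : IsDensity ρ) (hf : MemL2 f ρ)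
    (hmean : ∫ x, ρ x * f x = 0) :
    ∫⁻ x, ‖f x‖ₑ ^ 2 ∂densityMeasure ρ ≤ differenceEnergy (densityMeasure ρ) f := by
  have := hρ.isProbabilityMeasure
  have hconst : ∀ c : ℝ, ∫⁻ x, ‖f x‖ₑ ^ 2 ∂densityMeasure ρ ≤
      ∫⁻ x, ‖f x - c‖ₑ ^ 2 ∂densityMeasure ρ := fun c => by
    have hfc : MemL2 (fun x => f x - c) ρ := hf.sub (memLp_const c)
    rw [hf.lintegral_enorm_sq_eq hρ, hfc.lintegral_enorm_sq_eq hρ]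
    refine ENNReal.ofReal_le_ofReal ?_
    have i1 : Integrable fun x => ρ x * ‖f x‖ ^ 2 := hf.integrable_mul_sq hρ
    have i2 : Integrable fun x => ρ x * f x :=
      (integrable_densityMeasure_iff hρ.measurable hρ.nonneg f).1 (hf.integrable one_le_two)
    have e : ∀ x, ‖f x - c‖ ^ 2 * ρ x = ρ x * ‖f x‖ ^ 2 + (-(2 * c) * (ρ x * f x) +
        c ^ 2 * ρ x) := fun x => by
      rw [Real.norm_eq_abs, Real.norm_eq_abs, sq_abs, sq_abs]
      ring
    have i3 : Integrable fun x => -(2 * c) * (ρ x * f x) + c ^ 2 * ρ x :=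
      (i2.const_mul _).add (hρ.integrable.const_mul _)
    simp_rw [e]
    rw [integral_add i1 i3, integral_add (i2.const_mul _) (hρ.integrable.const_mul _),
      integral_const_mul, integral_const_mul, hmean, hρ.integral_eq_one]
    simp_rw [mul_comm (ρ _)]
    nlinarith [sq_nonneg c]
  calc ∫⁻ x, ‖f x‖ₑ ^ 2 ∂densityMeasure ρ
      = ∫⁻ _, (∫⁻ x, ‖f x‖ₑ ^ 2 ∂densityMeasure ρ) ∂densityMeasure ρ := by
        rw [lintegral_const, measure_univ, mul_one]
    _ ≤ _ := lintegral_mono fun y => hconst (f y)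

/-- Adding one to the constant keeps its inverse meaningful when `A = 0`. -/
lemma poincareInequality_of_differenceEnergy_le (hρ : IsDensity ρ) (hA : A ≠ ⊤)
    (h : ∀ (f : State d → ℝ) (g : State d → State d), HasWeakGradient f g → MemL2 f ρ →
      differenceEnergy (densityMeasure ρ) f ≤ A * ∫⁻ x, ‖g x‖ₑ ^ 2 ∂densityMeasure ρ) :
    PoincareInequality ρ (A.toReal + 1)⁻¹ := by
  intro f g hf hfg hg hmean
  have h1 := (lintegral_enorm_sq_le_differenceEnergy hρ hf hmean).trans (h f g hfg hf)
  have hg0 : 0 ≤ ∫ x, ‖g x‖ ^ 2 * ρ x :=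
    integral_nonneg fun x => mul_nonneg (by positivity) (hρ.nonneg x)
  rw [hf.lintegral_enorm_sq_eq hρ, hg.lintegral_enorm_sq_eq hρ, ← ENNReal.ofReal_toReal hA,
    ← ENNReal.ofReal_mul ENNReal.toReal_nonneg,
    ENNReal.ofReal_le_ofReal_iff (mul_nonneg ENNReal.toReal_nonneg hg0)] at h1
  rw [one_div, inv_inv]
  simp_rw [← Real.norm_eq_abs]
  linarith

/-- Stability of the control of the difference energy under bounded changes of density. -/
lemma differenceEnergy_le_of_comparable {σ : State d → ℝ} {E : ℝ} (hE : 0 ≤ E)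
    (h : ∀ (f : State d → ℝ) (g : State d → State d), HasWeakGradient f g → MemL2 f ρ →
      differenceEnergy (densityMeasure ρ) f ≤ A * ∫⁻ x, ‖g x‖ₑ ^ 2 ∂densityMeasure ρ)
    (hσρ : ∀ x, σ x ≤ E * ρ x) (hρσ : ∀ x, ρ x ≤ E * σ x)
    (f : State d → ℝ) (g : State d → State d) (hfg : HasWeakGradient f g) (hf : MemL2 f σ) :
    differenceEnergy (densityMeasure σ) f ≤
      ENNReal.ofReal E ^ 3 * A * ∫⁻ x, ‖g x‖ₑ ^ 2 ∂densityMeasure σ := by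
  -- Two factors `E` come from the two copies of the measure in the double integral, the third from
  -- the gradient term.
  calc differenceEnergy (densityMeasure σ) f
      ≤ ENNReal.ofReal E * (ENNReal.ofReal E * differenceEnergy (densityMeasure ρ) f) :=
        differenceEnergy_mono ENNReal.ofReal_ne_top (densityMeasure_mono hE hσρ) f
    _ ≤ ENNReal.ofReal E * (ENNReal.ofReal E *
          (A * (ENNReal.ofReal E * ∫⁻ x, ‖g x‖ₑ ^ 2 ∂densityMeasure σ))) := by
        gcongr
        refine (h f g hfg (hf.mono_density hE hρσ)).trans ?_
        gcongr
        rw [← smul_eq_mul (ENNReal.ofReal E), ← lintegral_smul_measure]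
        exact lintegral_mono' (densityMeasure_mono hE hρσ) le_rfl
    _ = _ := by ring

end Poincare

end DataAssimilation

/-! ### The main theorem -/

open DataAssimilation in
theorem proposition1 (d : ℕ) (p₀ h : State d → ℝ) (T : ℝ) (hT : 0 < T)
    (hA1 : AssumptionA1 p₀) (hA2 : AssumptionA2 h) :
    -- constants of part (ii): they depend neither on the path, nor on `N`, the instants or `n`
    ∃ C α : ℝ, ∀ Z : ℝ → ℝ, ContinuousOn Z (Icc 0 T) →
      -- constants of parts (i) and (iv): they may depend on the path, not on `N`, instants or `n`
      ∃ (K : ℝ) (R : ℝ → ℝ) (lam : ℝ), 0 < lam ∧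
        ∀ (N : ℕ) (t : ℕ → ℝ), IsPartition T N t →
          -- minimizers exist and are unique as densities
          (∃ ρ : ℕ → State d → ℝ, IsTimeStepping p₀ h N t Z ρ) ∧
          (∀ ρ ρ' : ℕ → State d → ℝ, IsTimeStepping p₀ h N t Z ρ → IsTimeStepping p₀ h N t Z ρ' →
            ∀ n ≤ N, ρ n =ᵐ[volume] ρ' n) ∧
          ∀ ρ : ℕ → State d → ℝ, IsTimeStepping p₀ h N t Z ρ →
            -- (i)
            (∃ G : ℕ → State d → ℝ, ∀ n ≤ N,
              ρ n =ᵐ[volume] (fun x => Real.exp (-G n x)) ∧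
              ContDiff ℝ 2 (G n) ∧
              (∀ x, ‖gradient (G n) x‖ ≤ K * (1 + ‖x‖)) ∧
              (∀ (M : ℝ) (x : State d), R M ≤ ‖x‖ → M ≤ ‖gradient (G n) x‖) ∧
              (∀ x, ‖hessian (G n) x‖ ≤ K)) ∧
            -- (ii)
            (∀ n < N, ∀ f : State d → ℝ, MemL2 f (ρ n) →
              MemL2 f (ρ (n + 1)) ∧
              ∫ x, ρ (n + 1) x * |f x| ^ 2 ≤
                C * Real.exp (α * |increment (Z ∘ t) n|) * ∫ x, ρ n x * |f x| ^ 2) ∧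
            -- (iii)
            (∀ n < N, MemH1 (fun x => ρ (n + 1) x / ρ n x) (ρ n)) ∧
            -- (iv)
            (∀ n ≤ N, PoincareInequality (ρ n) lam) := by
  obtain ⟨hp, G₀, hG, hG2, hGhess, hGlim⟩ := hA1
  obtain ⟨hh2, hh, hh', hh''⟩ := hA2
  have hhm : Measurable h := hh2.continuous.measurable
  obtain ⟨H, hH0, hH⟩ := exists_forall_norm_le_of_memLp_top hh2.continuous hh
  simp_rw [Real.norm_eq_abs] at hH
  obtain ⟨H₁, hH₁0, hH₁⟩ := exists_forall_norm_le_of_memLp_top (contDiff_gradient hh2).continuous hh'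
  obtain ⟨H₂, hH₂0, hH₂⟩ := exists_forall_norm_le_of_memLp_top (continuous_hessian hh2) hh''
  obtain ⟨K₀, hK₀0, hK₀⟩ := exists_forall_norm_le_of_memLp_top (continuous_hessian hG2) hGhess
  obtain ⟨A, hA, hPoinc⟩ := exists_differenceEnergy_le hp hG hG2 hK₀ hGlim
  choose R₀ _ hR₀ using exists_forall_le_norm_of_tendsto hGlim
  -- The oscillation bound `2H|ΔZ| + (Δt/2)H²` of a one-step exponent, with `Δt ≤ T`; chosen before
  -- the path.
  refine ⟨Real.exp (T / 2 * H ^ 2), 2 * H, fun Z hZ => ?_⟩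
  obtain ⟨W, hW⟩ := isCompact_Icc.exists_bound_of_continuousOn hZ
  have hW0 : 0 ≤ W := (norm_nonneg _).trans (hW 0 ⟨le_rfl, hT.le⟩)
  set B₁ := (2 * W + T * H) * H₁
  set B₂ := (2 * W + T * H) * H₂ + T * H₁ ^ 2
  have hB₁0 : 0 ≤ B₁ := by positivity
  have hB₂0 : 0 ≤ B₂ := by positivity
  -- Exponential of an oscillation bound for the accumulated exponent, using `|Z (t n) - Z (t 0)| ≤
  -- 2W`.
  set E := Real.exp (2 * (2 * W * H) + T / 2 * H ^ 2)
  -- `B₁` and `B₂` bound the gradient and Hessian of the accumulated exponent. Since the gradient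
  -- moves by at most `B₁`, the radius for level `M` is that of `G₀` for level `M + B₁`.
  refine ⟨‖gradient G₀ 0‖ + K₀ + B₁ + B₂, fun M => R₀ (M + B₁),
    ((ENNReal.ofReal E ^ 3 * A).toReal + 1)⁻¹, by positivity, fun N t ht => ?_⟩
  have hincr : ∀ n ≤ N, |Z (t n) - Z (t 0)| ≤ 2 * W := fun n hn => by
    have h1 := hW _ (ht.mem_Icc hn)
    have h2 := hW _ (ht.mem_Icc (Nat.zero_le N))
    rw [Real.norm_eq_abs] at h1 h2
    linarith [abs_sub (Z (t n)) (Z (t 0))]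
  refine ⟨⟨_, isTimeStepping_posterior hp hhm hH ht⟩, fun ρ ρ' hρ hρ' n hn =>
    (hρ.ae_eq_posterior hp hhm hH ht hn).trans (hρ'.ae_eq_posterior hp hhm hH ht hn).symm,
    fun ρ hρ => ?_⟩
  have hdens : ∀ n ≤ N, IsDensity (ρ n) := fun n hn => by
    rcases n with _ | n
    · rw [hρ.initial]; exact hp
    · exact hρ.mem n hn
  have hpost : ∀ n ≤ N, ρ n =ᵐ[volume] posterior p₀ h t Z n := fun n hn =>
    hρ.ae_eq_posterior hp hhm hH ht hn
  have hstep : ∀ n < N, ρ (n + 1) =ᵐ[volume]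
      gibbsDensity (ρ n) (logLikelihood h (increment t n) (increment (Z ∘ t) n)) := fun n hn => by
    refine (hpost (n + 1) hn).trans ?_
    rw [posterior_succ hp hhm hH ht hn.le]
    exact gibbsDensity_congr (hpost n hn.le).symm _
  refine ⟨⟨fun n => posteriorPotential G₀ h (t n) (Z (t n) - Z (t 0))
    (Real.log (∫ y, p₀ y * Real.exp (logLikelihood h (t n) (Z (t n) - Z (t 0)) y))),
    fun n hn => ?_⟩, fun n hn f hf => ?_, fun n hn => ?_, fun n hn => ?_⟩
  · obtain ⟨ht0, htT⟩ := ht.mem_Icc hn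
    have hg := norm_gradient_logLikelihood_le hh2 hH hH₁ (hincr n hn) ht0 htT
    have hhe := norm_hessian_logLikelihood_le hh2 hH hH₁ hH₂ (hincr n hn) ht0 htT
    refine ⟨?_, contDiff_posteriorPotential hG2 hh2, fun x => ?_, fun M x hx => ?_, fun x => ?_⟩
    · filter_upwards [hpost n hn] with x hx
      rw [hx, posterior, gibbsDensity_eq_exp_neg_potential hp hG hhm hH ht0]
    · rw [gradient_posteriorPotential hG2 hh2]
      have h1 := norm_gradient_le_add_mul hG2 hK₀ x
      have h2 := norm_sub_le (gradient G₀ x)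
        (gradient (logLikelihood h (t n) (Z (t n) - Z (t 0))) x)
      have h3 := hg x
      have h4 : 0 ≤ (‖gradient G₀ 0‖ + B₁ + B₂) * ‖x‖ := by positivity
      nlinarith
    · rw [gradient_posteriorPotential hG2 hh2]
      have h1 := hR₀ (M + B₁) x hx
      have h2 := norm_sub_norm_le (gradient G₀ x)
        (gradient (logLikelihood h (t n) (Z (t n) - Z (t 0))) x)
      linarith [hg x]
    · rw [hessian_posteriorPotential hG2 hh2]
      linarith [norm_sub_le (hessian G₀ x)
        (hessian (logLikelihood h (t n) (Z (t n) - Z (t 0))) x), hhe x, hK₀ x,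
        norm_nonneg (gradient G₀ 0)]
  · have hΔ := (ht.increment_pos hn).le
    have hΔT : increment t n ≤ T := by
      have h1 := (ht.mem_Icc hn.le).1
      have h2 := (ht.mem_Icc (Nat.succ_le_of_lt hn)).2
      unfold increment
      linarith
    have hm := measurable_logLikelihood (Δt := increment t n) (ΔZ := increment (Z ∘ t) n) hhm
    have hσ := isDensity_gibbsDensity (hdens n hn.le) hm (le_logLikelihood hH hΔ)
      (logLikelihood_le hH hΔ)
    have hle : ∀ x, gibbsDensity (ρ n)
        (logLikelihood h (increment t n) (increment (Z ∘ t) n)) x ≤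
        Real.exp (T / 2 * H ^ 2) * Real.exp (2 * H * |increment (Z ∘ t) n|) * ρ n x := fun x => by
      refine (gibbsDensity_le (hdens n hn.le) hm (le_logLikelihood hH hΔ)
        (logLikelihood_le hH hΔ) x).trans (mul_le_mul_of_nonneg_right ?_ ((hdens n hn.le).nonneg x))
      rw [← Real.exp_add]
      refine Real.exp_le_exp.2 ?_
      have h1 : increment t n / 2 * H ^ 2 ≤ T / 2 * H ^ 2 := by gcongr
      linarith
    refine ⟨(hf.mono_density (by positivity) hle).congr_density (hstep n hn).symm, ?_⟩
    refine le_trans (le_of_eq ?_)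
      (integral_mul_sq_le hσ (hdens n hn.le) hf (by positivity) hle)
    refine integral_congr_ae ?_
    filter_upwards [hstep n hn] with x hx
    rw [hx, Real.norm_eq_abs]
  · have hΔ := (ht.increment_pos hn).le
    have hm := measurable_logLikelihood (Δt := increment t n) (ΔZ := increment (Z ∘ t) n) hhm
    refine memH1_exp_div (hdens n hn.le)
      (q := logLikelihood h (increment t n) (increment (Z ∘ t) n))
      (contDiff_logLikelihood (hh2.of_le one_le_two))
      (integral_mul_exp_pos (hdens n hn.le) hm (le_logLikelihood hH hΔ) (logLikelihood_le hH hΔ))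
      (logLikelihood_le hH hΔ)
      -- Only membership is claimed, so this bound may depend on the step.
      (norm_gradient_logLikelihood_le hh2 hH hH₁ le_rfl hΔ le_rfl) ?_
    filter_upwards [hstep n hn, hpost n hn.le] with x hx hx'
    -- Positivity allows division by `ρ n x`.
    have hpos : 0 < ρ n x := by
      rw [hx']
      exact gibbsDensity_pos hp hG hhm hH (ht.mem_Icc hn.le).1 x
    rw [hx, gibbsDensity]
    field_simp
  · obtain ⟨ht0, htT⟩ := ht.mem_Icc hn
    have hm := measurable_logLikelihood (Δt := t n) (ΔZ := Z (t n) - Z (t 0)) hhm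
    have hlo := le_logLikelihood (ΔZ := Z (t n) - Z (t 0)) hH ht0
    have hup := logLikelihood_le (ΔZ := Z (t n) - Z (t 0)) hH ht0
    have hσ := isDensity_gibbsDensity hp hm hlo hup
    have hexp : Real.exp (|Z (t n) - Z (t 0)| * H -
        -(|Z (t n) - Z (t 0)| * H + t n / 2 * H ^ 2)) ≤ E := by
      refine Real.exp_le_exp.2 ?_
      have h1 : |Z (t n) - Z (t 0)| * H ≤ 2 * W * H :=
        mul_le_mul_of_nonneg_right (hincr n hn) hH0
      have h2 : t n / 2 * H ^ 2 ≤ T / 2 * H ^ 2 := by gcongr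
      linarith
    refine poincareInequality_of_differenceEnergy_le (hdens n hn) (by finiteness) ?_
    intro f g hfg hf
    rw [densityMeasure_congr (hpost n hn)]
    exact differenceEnergy_le_of_comparable (Real.exp_nonneg _) hPoinc
      (fun x => (gibbsDensity_le hp hm hlo hup x).trans
        (mul_le_mul_of_nonneg_right hexp (hp.nonneg x)))
      (fun x => (le_gibbsDensity hp hm hlo hup x).trans
        (mul_le_mul_of_nonneg_right hexp (hσ.nonneg x)))
      f g hfg (hf.congr_density (hpost n hn))
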